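/- Let $d\ge 1$, let $u_1,\dots,u_m$ be contracting similarities of $\mathbb{R}^d$ with the Euclidean metric, i.e. $\|u_i(x)-u_i(y)\|=r_i\|x-y\|$ for all $x,y$ with some $0<r_i<1$, and let $K$ be their limit set, i.e. the nonempty compact set with $K=\bigcup_{i=1}^m u_i(K)$. Write $B(x,\rho)$ for the closed ball and $\mathcal{L}^{(\varepsilon)}=\{y: \operatorname{dist}(y,\mathcal{L})\le\varepsilon\}$. Affine subspaces are nonempty, and a hyperplane is an affine subspace of dimension $d-1$. (1) $K$ is contained in no affine hyperplane if and only if there is no nonempty finite collection $\{\mathcal{L}_1,\dots,\mathcal{L}_k\}$ of proper affine subspaces of $\mathbb{R}^d$ that is invariant under the family, in the sense that each $u_i$ maps each $\mathcal{L}_j$ onto some $\mathcal{L}_{j'}$. (2) Suppose that $K$ is contained in no affine hyperplane and that the open set condition holds: there is a nonempty open set $U\subseteq\mathbb{R}^d$ such that the sets $u_i(U)$, $1\le i\le m$, are contained in $U$ and pairwise disjoint. Let $\delta=\dim_H K$ be the Hausdorff dimension of $K$, and let $\mu=\mathcal{H}^{\delta}|_K$ be the restriction to $K$ of the $\delta$-dimensional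 Hausdorff measure. Then $\delta>0$, $\mu$ is locally finite, $\operatorname{supp}\mu=K$, and: (a) $\mu$ is $\delta$-Ahlfors regular: there are $c_1,c_2,\rho_0>0$ such that $c_1\rho^\delta\le\mu(B(x,\rho))\le c_2\rho^\delta$ for all $x\in\operatorname{supp}\mu$ and $0<\rho<\rho_0$; (b) $\mu$ is absolutely decaying: there are $C,\gamma,\rho_0>0$ such that $\mu(B(x,\rho)\cap\mathcal{L}^{(\varepsilon\rho)})<C\varepsilon^\gamma\mu(B(x,\rho))$ for all $0<\rho<\rho_0$, $x\in\operatorname{supp}\mu$, affine hyperplanes $\mathcal{L}$ and $\varepsilon>0$; (c) $K$ is hyperplane diffuse: $K$ is closed and there are $0<\beta<1$ and $\rho_K>0$ such that for all $0<\rho\le\rho_K$, all $x\in K$ and all affine hyperplanes $\mathcal{L}$ there is $x'\in K\cap B(x,\rho)\setminus\mathcal{L}^{(\beta\rho)}$. -/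

import Mathlib

namespace SelfSimilar

variable {d : ℕ}

/-- `f` is a contracting similarity of `ℝ^d`: it multiplies all Euclidean distances by one ratio
`r` with `0 < r < 1`. -/
def IsContractingSimilarity (f : EuclideanSpace ℝ (Fin d) → EuclideanSpace ℝ (Fin d)) : Prop :=
  ∃ r : ℝ, 0 < r ∧ r < 1 ∧ ∀ x y, dist (f x) (f y) = r * dist x y

/-- The open set condition: some nonempty open set `U` contains its images `u i '' U`, and these
images are pairwise disjoint. -/
def OpenSetCondition {m : ℕ}
    (u : Fin m → EuclideanSpace ℝ (Fin d) → EuclideanSpace ℝ (Fin d)) : Prop :=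
  ∃ U : Set (EuclideanSpace ℝ (Fin d)), U.Nonempty ∧ IsOpen U ∧
    (∀ i, u i '' U ⊆ U) ∧ ∀ i j, i ≠ j → Disjoint (u i '' U) (u j '' U)

/-- `K` is the limit set of the family `u`: the nonempty compact set with `K = ⋃ i, u i '' K`
(for contractions there is at most one, and exactly one when `m ≥ 1`). -/
def IsLimitSet {m : ℕ} (u : Fin m → EuclideanSpace ℝ (Fin d) → EuclideanSpace ℝ (Fin d))
    (K : Set (EuclideanSpace ℝ (Fin d))) : Prop :=
  K.Nonempty ∧ IsCompact K ∧ K = ⋃ i, u i '' K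

/-- `L` is a (nonempty) `k`-dimensional affine subspace of `ℝ^d`. -/
def IsAffineOfDim (k : ℕ) (L : AffineSubspace ℝ (EuclideanSpace ℝ (Fin d))) : Prop :=
  (L : Set (EuclideanSpace ℝ (Fin d))).Nonempty ∧ Module.finrank ℝ L.direction = k

/-- `L` is an affine hyperplane of `ℝ^d`, i.e. an affine subspace of dimension `d - 1`. -/
def IsHyperplane (L : AffineSubspace ℝ (EuclideanSpace ℝ (Fin d))) : Prop :=
  ∃ k : ℕ, k + 1 = d ∧ IsAffineOfDim k L

/-- A nonempty finite collection of proper (nonempty) affine subspaces that is invariant under the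
family `u`: every `u i` maps every member of the collection onto a member of the collection. -/
def IsInvariantCollection {m : ℕ}
    (u : Fin m → EuclideanSpace ℝ (Fin d) → EuclideanSpace ℝ (Fin d))
    (S : Finset (AffineSubspace ℝ (EuclideanSpace ℝ (Fin d)))) : Prop :=
  S.Nonempty ∧
  (∀ L ∈ S, (L : Set (EuclideanSpace ℝ (Fin d))).Nonempty ∧ L ≠ ⊤) ∧
  ∀ i, ∀ L ∈ S, ∃ L' ∈ S, u i '' (L : Set (EuclideanSpace ℝ (Fin d))) = L'

/-- `K` is `k`-dimensionally `β`-diffuse. -/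
def IsDiffuseWith (k : ℕ) (β : ℝ) (K : Set (EuclideanSpace ℝ (Fin d))) : Prop :=
  IsClosed K ∧ ∃ ρK : ℝ, 0 < ρK ∧ ∀ ρ : ℝ, 0 < ρ → ρ ≤ ρK → ∀ x ∈ K,
    ∀ L : AffineSubspace ℝ (EuclideanSpace ℝ (Fin d)), IsAffineOfDim k L →
      ∃ x' ∈ K, x' ∈ Metric.closedBall x ρ \
        Metric.cthickening (β * ρ) (L : Set (EuclideanSpace ℝ (Fin d)))

/-- `K` is hyperplane diffuse: `(d-1)`-dimensionally `β`-diffuse for some `0 < β < 1`. -/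
def IsHyperplaneDiffuse (K : Set (EuclideanSpace ℝ (Fin d))) : Prop :=
  ∃ k : ℕ, k + 1 = d ∧ ∃ β : ℝ, 0 < β ∧ β < 1 ∧ IsDiffuseWith k β K

/-- The locally finite Borel measure `μ` on `ℝ^d` is `δ`-Ahlfors regular. -/
def IsAhlforsRegular (δ : ℝ) (μ : MeasureTheory.Measure (EuclideanSpace ℝ (Fin d))) : Prop :=
  MeasureTheory.IsLocallyFiniteMeasure μ ∧
  ∃ c₁ c₂ ρ₀ : ℝ, 0 < c₁ ∧ 0 < c₂ ∧ 0 < ρ₀ ∧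
    ∀ x ∈ μ.support, ∀ ρ : ℝ, 0 < ρ → ρ < ρ₀ →
      ENNReal.ofReal (c₁ * ρ ^ δ) ≤ μ (Metric.closedBall x ρ) ∧
      μ (Metric.closedBall x ρ) ≤ ENNReal.ofReal (c₂ * ρ ^ δ)

/-- The locally finite Borel measure `μ` on `ℝ^d` is `(C, γ)`-absolutely decaying for some
`C, γ > 0`. -/
def IsAbsolutelyDecaying (μ : MeasureTheory.Measure (EuclideanSpace ℝ (Fin d))) : Prop :=
  MeasureTheory.IsLocallyFiniteMeasure μ ∧
  ∃ C γ ρ₀ : ℝ, 0 < C ∧ 0 < γ ∧ 0 < ρ₀ ∧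
    ∀ ρ : ℝ, 0 < ρ → ρ < ρ₀ → ∀ x ∈ μ.support,
    ∀ L : AffineSubspace ℝ (EuclideanSpace ℝ (Fin d)), IsHyperplane L →
    ∀ ε : ℝ, 0 < ε →
      μ (Metric.closedBall x ρ ∩
          Metric.cthickening (ε * ρ) (L : Set (EuclideanSpace ℝ (Fin d)))) <
        ENNReal.ofReal (C * ε ^ γ) * μ (Metric.closedBall x ρ)

/-- Hausdorff measure on `K` in the dimension `δ = dim_H K`, as a measure on `ℝ^d`. -/
noncomputable def hausdorffOn (K : Set (EuclideanSpace ℝ (Fin d))) :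
    MeasureTheory.Measure (EuclideanSpace ℝ (Fin d)) :=
  (MeasureTheory.Measure.hausdorffMeasure (dimH K).toReal).restrict K

end SelfSimilar

/-! For (1), the affine span of `K` is itself invariant, so if `K` lies in a hyperplane this span is
an invariant collection of one member. Conversely, the union of an invariant collection is closed
and forward invariant. Orbits accumulate on all of `K`, so the union contains `K`. By Baire one
member contains a relatively open piece of `K`, hence a cylinder, and pulling back by the similarity
of that cylinder puts `K` in a proper affine subspace.

For (2), let `s` solve `∑ r i ^ s = 1`. Covering by cylinders gives `μH[s] K < ∞`. Under the open
set condition a volume count (`exists_card_le`) bounds the number of cylinders of size about `ρ`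
that meet a `ρ`-ball, and the mass distribution principle gives `μH[s] K > 0`, so `dimH K = s`. The
same count and exact scaling on cylinders give Ahlfors regularity.

Decay rests on `exists_cylinder_lt_infDist`: every proper affine subspace stays a fixed distance
away from some cylinder of one fixed level. Iterating this inside the remaining cylinders
(`hausdorffMeasure_nhd_iterate`) gives geometric decay of the measure of thin neighbourhoods of
subspaces; the volume count localises it to balls. Diffuseness comes from renormalising one cylinder
inside the ball. -/

open Metric Set MeasureTheory Filter
open scoped ENNReal NNReal Topology

namespace SelfSimilar

/-! ### Words and stopping words. -/

section Words

variable {m : ℕ} {X : Type*}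

/-- The composition `u i₁ ∘ ⋯ ∘ u iₙ` along a word. -/
def wordMap (u : Fin m → X → X) : List (Fin m) → X → X
  | [] => id
  | i :: w => u i ∘ wordMap u w

/-- The product of the ratios along a word. -/
def wordRatio (r : Fin m → ℝ) (w : List (Fin m)) : ℝ := (w.map r).prod

/-- The words whose ratio drops to `ρ` or below for the first time at their last letter. -/
def IsStopping (r : Fin m → ℝ) : ℝ → List (Fin m) → Prop
  | ρ, [] => 1 ≤ ρ
  | ρ, i :: w => ρ < 1 ∧ IsStopping r (ρ / r i) w

@[simp] theorem wordMap_nil (u : Fin m → X → X) : wordMap u [] = id := rfl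

@[simp] theorem wordMap_cons (u : Fin m → X → X) (i : Fin m) (w : List (Fin m)) :
    wordMap u (i :: w) = u i ∘ wordMap u w := rfl

@[simp] theorem wordRatio_nil (r : Fin m → ℝ) : wordRatio r [] = 1 := rfl

@[simp] theorem wordRatio_cons (r : Fin m → ℝ) (i : Fin m) (w : List (Fin m)) :
    wordRatio r (i :: w) = r i * wordRatio r w := by
  simp [wordRatio]

theorem image_wordMap_subset {u : Fin m → X → X} {O : Set X} (hO : ∀ i, u i '' O ⊆ O) :
    ∀ w, wordMap u w '' O ⊆ O
  | [] => by simp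
  | i :: w => by
      rw [wordMap_cons, image_comp]
      exact (image_mono (image_wordMap_subset hO w)).trans (hO i)

theorem mapsTo_biUnion_wordMap {ι : Type*} {u : Fin m → X → X} {S : Set ι} {c : ι → Set X}
    (h : ∀ i, ∀ l ∈ S, ∃ l' ∈ S, u i '' c l = c l') {x : X} (hx : x ∈ ⋃ l ∈ S, c l) :
    ∀ w, wordMap u w x ∈ ⋃ l ∈ S, c l
  | [] => hx
  | i :: w => by
      obtain ⟨l, hl, hy⟩ := mem_iUnion₂.1 (mapsTo_biUnion_wordMap h hx w)
      obtain ⟨l', hl', he⟩ := h i l hl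
      exact mem_iUnion₂.2 ⟨l', hl', he ▸ mem_image_of_mem _ hy⟩

theorem wordRatio_ofFn (r : Fin m → ℝ) {n : ℕ} (p : Fin n → Fin m) :
    wordRatio r (List.ofFn p) = ∏ k, r (p k) := by
  simp [wordRatio, List.map_ofFn, List.prod_ofFn]

theorem le_wordRatio_ofFn {r : Fin m → ℝ} {a : ℝ} (ha : 0 ≤ a) (h : ∀ i, a ≤ r i) {n : ℕ}
    (p : Fin n → Fin m) : a ^ n ≤ wordRatio r (List.ofFn p) := by
  rw [wordRatio_ofFn]
  calc a ^ n = ∏ _k : Fin n, a := by simp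
    _ ≤ _ := Finset.prod_le_prod (fun _ _ => ha) fun _ _ => h _

theorem wordRatio_ofFn_le {r : Fin m → ℝ} {b : ℝ} (h0 : ∀ i, 0 ≤ r i) (h : ∀ i, r i ≤ b) {n : ℕ}
    (p : Fin n → Fin m) : wordRatio r (List.ofFn p) ≤ b ^ n := by
  rw [wordRatio_ofFn]
  calc _ ≤ ∏ _k : Fin n, b := Finset.prod_le_prod (fun _ _ => h0 _) fun _ _ => h _
    _ = b ^ n := by simp

theorem wordRatio_pos {r : Fin m → ℝ} (h : ∀ i, 0 < r i) : ∀ w, 0 < wordRatio r w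
  | [] => by simp
  | i :: w => by
      rw [wordRatio_cons]
      exact mul_pos (h i) (wordRatio_pos h w)

theorem IsStopping.wordRatio_le {r : Fin m → ℝ} (h : ∀ i, 0 < r i) :
    ∀ {w : List (Fin m)} {ρ : ℝ}, IsStopping r ρ w → wordRatio r w ≤ ρ
  | [], _, hw => hw
  | i :: w, ρ, hw => by
      have := IsStopping.wordRatio_le h hw.2
      rw [le_div_iff₀ (h i)] at this
      rw [wordRatio_cons]
      linarith

/-- The ratio still exceeds `ρ` before the last letter, which costs at most a factor `a`. With `ρ <
1` the word has a last letter. -/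
theorem IsStopping.le_wordRatio {r : Fin m → ℝ} {a : ℝ} (h : ∀ i, 0 < r i)
    (ha : 0 < a) (har : ∀ i, a ≤ r i) :
    ∀ {w : List (Fin m)} {ρ : ℝ}, 0 < ρ → ρ < 1 → IsStopping r ρ w → a * ρ ≤ wordRatio r w
  | [], _, _, hρ, hw => absurd hw (not_le.2 hρ)
  | [i], ρ, _, hρ, hw => by
      have := har i
      simp only [wordRatio_cons, wordRatio_nil]
      nlinarith
  | i :: j :: w, ρ, hρ0, hρ, hw => by
      have := IsStopping.le_wordRatio h ha har (div_pos hρ0 (h i)) hw.2.1 hw.2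
      rw [wordRatio_cons]
      calc a * ρ = r i * (a * (ρ / r i)) := by have := (h i).ne'; field_simp
        _ ≤ _ := mul_le_mul_of_nonneg_left this (h i).le

/-- No stopping word is a proper prefix of another for the same `ρ`, so distinct ones part at some
letter, where the open set condition separates them. -/
theorem IsStopping.disjoint_image {r : Fin m → ℝ} {u : Fin m → X → X} {O : Set X}
    (hu : ∀ i, Function.Injective (u i)) (hO : ∀ i, u i '' O ⊆ O)
    (hd : ∀ i j, i ≠ j → Disjoint (u i '' O) (u j '' O)) :
    ∀ {v w : List (Fin m)} {ρ : ℝ}, IsStopping r ρ v → IsStopping r ρ w → v ≠ w →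
      Disjoint (wordMap u v '' O) (wordMap u w '' O)
  | [], [], _, _, _, h => absurd rfl h
  | [], _ :: _, _, hv, hw, _ => absurd hv (not_le.2 hw.1)
  | _ :: _, [], _, hv, hw, _ => absurd hw (not_le.2 hv.1)
  | i :: v, j :: w, ρ, hv, hw, h => by
      simp only [wordMap_cons, image_comp]
      by_cases hij : i = j
      · subst hij
        exact disjoint_image_of_injective (hu i)
          (IsStopping.disjoint_image hu hO hd hv.2 hw.2 fun h' => h (by rw [h']))
      · exact (hd i j hij).mono (image_mono (image_wordMap_subset hO v))
          (image_mono (image_wordMap_subset hO w))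

end Words

/-! ### Cylinders of the limit set. -/

/-- A finite family `u` of contracting similarities with ratios `r` and its limit set `K`. -/
structure IsSystem {m : ℕ} {X : Type*} [MetricSpace X] (u : Fin m → X → X) (r : Fin m → ℝ)
    (K : Set X) : Prop where
  pos : ∀ i, 0 < r i
  lt_one : ∀ i, r i < 1
  dist_eq : ∀ i x y, dist (u i x) (u i y) = r i * dist x y
  nonempty : K.Nonempty
  compact : IsCompact K
  eq : K = ⋃ i, u i '' K

theorem exists_pos_forall_le {m : ℕ} {r : Fin m → ℝ} (h : ∀ i, 0 < r i) :
    ∃ a, 0 < a ∧ a < 1 ∧ ∀ i, a ≤ r i := by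
  have h1 : ∀ᶠ a in nhdsWithin (0 : ℝ) (Ioi 0), ∀ i, a ≤ r i :=
    Filter.eventually_all.2 fun i => nhdsWithin_le_nhds (Iic_mem_nhds (h i))
  have h2 : ∀ᶠ a in nhdsWithin (0 : ℝ) (Ioi 0), a < 1 :=
    nhdsWithin_le_nhds (Iio_mem_nhds zero_lt_one)
  have h3 : ∀ᶠ a in nhdsWithin (0 : ℝ) (Ioi 0), 0 < a := self_mem_nhdsWithin
  obtain ⟨a, h1, h2, h3⟩ := (h1.and (h2.and h3)).exists
  exact ⟨a, h3, h2, h1⟩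

theorem exists_lt_one_forall_le {m : ℕ} {r : Fin m → ℝ} (h : ∀ i, r i < 1) :
    ∃ b, 0 < b ∧ b < 1 ∧ ∀ i, r i ≤ b := by
  obtain ⟨a, h0, h1, h2⟩ := exists_pos_forall_le (r := fun i => 1 - r i) fun i => sub_pos.2 (h i)
  exact ⟨1 - a, by linarith, by linarith, fun i => by linarith [h2 i]⟩

namespace IsSystem

variable {m : ℕ} {X : Type*} [MetricSpace X] {u : Fin m → X → X} {r : Fin m → ℝ} {K : Set X}

theorem dist_wordMap (h : IsSystem u r K) (x y : X) :
    ∀ w, dist (wordMap u w x) (wordMap u w y) = wordRatio r w * dist x y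
  | [] => by simp
  | i :: w => by
      simp only [wordMap_cons, Function.comp, wordRatio_cons]
      rw [h.dist_eq, h.dist_wordMap x y w, mul_assoc]

theorem ratio_pos (h : IsSystem u r K) (w : List (Fin m)) : 0 < wordRatio r w :=
  wordRatio_pos h.pos w

theorem injective (h : IsSystem u r K) (i : Fin m) : Function.Injective (u i) := by
  intro x y hxy
  have := h.dist_eq i x y
  rw [hxy, dist_self, eq_comm, mul_eq_zero] at this
  exact dist_eq_zero.1 (this.resolve_left (h.pos i).ne')

theorem image_subset (h : IsSystem u r K) (i : Fin m) : u i '' K ⊆ K := by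
  conv_rhs => rw [h.eq]
  exact subset_iUnion (fun i => u i '' K) i

theorem wordMap_mem (h : IsSystem u r K) (w : List (Fin m)) {x : X} (hx : x ∈ K) :
    wordMap u w x ∈ K :=
  image_wordMap_subset h.image_subset w (mem_image_of_mem _ hx)

theorem exists_preimage (h : IsSystem u r K) {x : X} (hx : x ∈ K) :
    ∃ i, ∃ y ∈ K, u i y = x := by
  rw [h.eq] at hx
  obtain ⟨i, y, hy, rfl⟩ := mem_iUnion.1 hx
  exact ⟨i, y, hy, rfl⟩

theorem subset_iUnion_ofFn (h : IsSystem u r K) :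
    ∀ n, K ⊆ ⋃ p : Fin n → Fin m, wordMap u (List.ofFn p) '' K
  | 0 => fun x hx => mem_iUnion.2 ⟨Fin.elim0, x, hx, by simp⟩
  | n + 1 => fun x hx => by
      obtain ⟨i, y, hy, rfl⟩ := h.exists_preimage hx
      obtain ⟨p, z, hz, rfl⟩ := mem_iUnion.1 (h.subset_iUnion_ofFn n hy)
      exact mem_iUnion.2 ⟨Fin.cons i p, z, hz, by simp⟩

/-- The induction is on an `n` with `b ^ n < ρ`: removing the first letter replaces `ρ` by `ρ / r
i`, which uses up one factor `b`. -/
theorem exists_isStopping (h : IsSystem u r K) {ρ : ℝ} (hρ : 0 < ρ) {x : X} (hx : x ∈ K) :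
    ∃ w, IsStopping r ρ w ∧ x ∈ wordMap u w '' K := by
  obtain ⟨b, hb0, hb1, hb⟩ := exists_lt_one_forall_le h.lt_one
  obtain ⟨n, hn⟩ := exists_pow_lt_of_lt_one hρ hb1
  induction n generalizing x ρ with
  | zero => exact ⟨[], by simpa [IsStopping] using hn.le, x, hx, rfl⟩
  | succ n ih =>
    by_cases h1 : 1 ≤ ρ
    · exact ⟨[], h1, x, hx, rfl⟩
    obtain ⟨i, y, hy, rfl⟩ := h.exists_preimage hx
    obtain ⟨w, hw, z, hz, rfl⟩ := ih (ρ := ρ / r i) (div_pos hρ (h.pos i)) hy (by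
      rw [lt_div_iff₀ (h.pos i)]
      refine lt_of_le_of_lt ?_ hn
      rw [pow_succ]
      exact mul_le_mul_of_nonneg_left (hb i) (by positivity))
    exact ⟨i :: w, ⟨not_le.1 h1, hw⟩, z, hz, rfl⟩

/-- A bound for the distances between points of `K`. -/
theorem exists_diam_bound (h : IsSystem u r K) : ∃ D, 1 ≤ D ∧ ∀ x ∈ K, ∀ y ∈ K, dist x y ≤ D := by
  obtain ⟨D, hD⟩ := isBounded_iff.1 h.compact.isBounded
  exact ⟨max D 1, le_max_right _ _, fun x hx y hy => (hD hx hy).trans (le_max_left _ _)⟩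

/-- Every point of `K` lies in a cylinder inside a given ball, of comparable size. -/
theorem exists_cylinder_subset_closedBall (h : IsSystem u r K) :
    ∃ c, 0 < c ∧ ∀ x ∈ K, ∀ ρ, 0 < ρ → ρ ≤ 1 → ∃ w, c * ρ ≤ wordRatio r w ∧
      wordMap u w '' K ⊆ closedBall x ρ := by
  obtain ⟨D, hD1, hD⟩ := h.exists_diam_bound
  obtain ⟨a, ha0, ha1, ha⟩ := exists_pos_forall_le h.pos
  have hD0 : 0 < D + 1 := by linarith
  -- Dividing by `D + 1` rather than `D` keeps the stopping threshold below `1` even for `ρ = 1`.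
  refine ⟨a / (D + 1), by positivity, fun x hx ρ h0 h1 => ?_⟩
  have hlt : ρ / (D + 1) < 1 := by rw [div_lt_one hD0]; linarith
  obtain ⟨w, hw, y, hy, rfl⟩ := h.exists_isStopping (div_pos h0 hD0) hx
  refine ⟨w, ?_, ?_⟩
  · have := hw.le_wordRatio h.pos ha0 ha (div_pos h0 hD0) hlt
    rwa [div_mul_eq_mul_div, ← mul_div_assoc] at *
  · rintro _ ⟨z, hz, rfl⟩
    rw [mem_closedBall, h.dist_wordMap]
    calc _ ≤ ρ / (D + 1) * (D + 1) :=
          mul_le_mul (hw.wordRatio_le h.pos) ((hD z hz y hy).trans (by linarith)) dist_nonneg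
            (by positivity)
      _ = ρ := by field_simp

/-- A point of `K` lies in a tiny cylinder, whose similarity also brings `x` close to it, although
`x` need not lie in `K`. -/
theorem subset_of_isClosed_of_mapsTo (h : IsSystem u r K) {C : Set X} (hC : IsClosed C) {x : X}
    (hx : ∀ w, wordMap u w x ∈ C) : K ⊆ C := by
  intro z hz
  obtain ⟨D, hD⟩ := (isBounded_iff.1 (h.compact.isBounded.insert x))
  rw [← hC.closure_eq, Metric.mem_closure_iff]
  intro ε hε
  have hD0 : 0 ≤ D := dist_nonneg.trans (hD (mem_insert x K) (mem_insert x K))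
  obtain ⟨w, hw, y, hy, rfl⟩ := h.exists_isStopping (ρ := ε / (D + 1)) (by positivity) hz
  refine ⟨_, hx w, ?_⟩
  rw [h.dist_wordMap]
  calc _ ≤ ε / (D + 1) * D := mul_le_mul (hw.wordRatio_le h.pos)
          (hD (mem_insert_of_mem _ hy) (mem_insert x K)) dist_nonneg (by positivity)
    _ < ε := by rw [div_mul_eq_mul_div, div_lt_iff₀ (by linarith)]; nlinarith

/-- With at most one letter there is only one stopping word at each scale, so any two points share
arbitrarily small cylinders. -/
theorem subsingleton (h : IsSystem u r K) (hm : m ≤ 1) : K.Subsingleton := by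
  have : Subsingleton (Fin m) := Fin.subsingleton_iff_le_one.2 hm
  obtain ⟨D, hD1, hD⟩ := h.exists_diam_bound
  intro x hx y hy
  refine dist_le_zero.1 (le_of_forall_pos_le_add fun ε hε => ?_)
  obtain ⟨w, hw, x', hx', rfl⟩ := h.exists_isStopping (ρ := ε / D) (by positivity) hx
  obtain ⟨v, hv, y', hy', rfl⟩ := h.exists_isStopping (ρ := ε / D) (by positivity) hy
  have aux : ∀ (v w : List (Fin m)) (ρ : ℝ), IsStopping r ρ v → IsStopping r ρ w → v = w := by
    intro v
    induction v with
    | nil =>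
      rintro (_ | ⟨j, w⟩) ρ hv hw
      · rfl
      · exact absurd hv (not_le.2 hw.1)
    | cons i v ih =>
      rintro (_ | ⟨j, w⟩) ρ hv hw
      · exact absurd hw (not_le.2 hv.1)
      · obtain rfl := Subsingleton.elim i j
        rw [ih w _ hv.2 hw.2]
  obtain rfl := aux v w _ hv hw
  rw [h.dist_wordMap, zero_add]
  calc _ ≤ ε / D * D := mul_le_mul (hw.wordRatio_le h.pos) (hD _ hx' _ hy') dist_nonneg
          (by positivity)
    _ = ε := by field_simp

end IsSystem

end SelfSimilar

namespace SelfSimilar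

theorem mem_cthickening_iff_infDist_le {X : Type*} [PseudoMetricSpace X] {s : Set X}
    (hs : s.Nonempty) {δ : ℝ} (hδ : 0 ≤ δ) {x : X} :
    x ∈ cthickening δ s ↔ infDist x s ≤ δ := by
  rw [mem_cthickening_iff, infDist, ENNReal.le_ofReal_iff_toReal_le (infEDist_ne_top hs) hδ]

/-! ### Proper affine subspaces. -/

section Affine

variable {V : Type*} [NormedAddCommGroup V] [InnerProductSpace ℝ V]

/-- A proper affine subspace: nonempty and not the whole space. -/
def IsProperAffine (L : AffineSubspace ℝ V) : Prop := (L : Set V).Nonempty ∧ L ≠ ⊤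

theorem IsProperAffine.exists_preimage {L : AffineSubspace ℝ V} (hL : IsProperAffine L)
    (A : V ≃ᵃ[ℝ] V) : ∃ L' : AffineSubspace ℝ V, IsProperAffine L' ∧ (L' : Set V) = A ⁻¹' L := by
  refine ⟨L.comap (A : V →ᵃ[ℝ] V), ⟨?_, ?_⟩, rfl⟩
  · obtain ⟨x, hx⟩ := hL.1
    obtain ⟨y, rfl⟩ := A.surjective x
    exact ⟨y, hx⟩
  · intro h
    refine hL.2 (eq_top_iff.2 fun x _ => ?_)
    obtain ⟨y, rfl⟩ := A.surjective x
    have : y ∈ L.comap (A : V →ᵃ[ℝ] V) := h ▸ AffineSubspace.mem_top ℝ V y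
    exact this

theorem IsProperAffine.direction_lt_top {L : AffineSubspace ℝ V} (hL : IsProperAffine L) :
    L.direction < ⊤ :=
  lt_top_iff_ne_top.2 fun h => hL.2 ((AffineSubspace.direction_eq_top_iff_of_nonempty hL.1).1 h)

variable [FiniteDimensional ℝ V]

/-- A similarity of a finite-dimensional inner product space is an affine equivalence. -/
theorem exists_affineEquiv_of_dist_eq {f : V → V} {r : ℝ} (hr : 0 < r)
    (hf : ∀ x y, dist (f x) (f y) = r * dist x y) : ∃ A : V ≃ᵃ[ℝ] V, ⇑A = f := by
  -- After division by the ratio the map is an isometry, and isometries into a strictly convex space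
  -- are affine.
  have hi : Isometry fun x => r⁻¹ • f x := Isometry.of_dist_eq fun x y => by
    rw [dist_smul₀, hf, Real.norm_of_nonneg (by positivity), ← mul_assoc, inv_mul_cancel₀ hr.ne',
      one_mul]
  let g : V →ᵃ[ℝ] V := r • hi.affineIsometryOfStrictConvexSpace.toAffineMap
  have hg : ⇑g = f := by
    ext1 x
    change r • r⁻¹ • f x = f x
    rw [smul_smul, mul_inv_cancel₀ hr.ne', one_smul]
  have hinj : Function.Injective g := by
    intro x y hxy
    have := hf x y
    rw [← hg, hxy, dist_self, eq_comm, mul_eq_zero] at this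
    exact dist_eq_zero.1 (this.resolve_left hr.ne')
  have hsurj : Function.Surjective g := g.linear_surjective_iff.1
    (LinearMap.injective_iff_surjective.1 (g.linear_injective_iff.2 hinj))
  exact ⟨AffineEquiv.ofBijective ⟨hinj, hsurj⟩, hg⟩

/-- The distance to a proper affine subspace dominates the variation of a unit normal form. -/
theorem IsProperAffine.exists_normal {L : AffineSubspace ℝ V} (hL : IsProperAffine L) :
    ∃ n : V, ‖n‖ = 1 ∧ ∀ x y, |inner ℝ n (x - y)| ≤ infDist x L + infDist y L := by
  have hne : L.directionᗮ ≠ ⊥ := fun h =>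
    hL.direction_lt_top.ne (Submodule.orthogonal_eq_bot_iff.1 h)
  obtain ⟨v, hv, hv0⟩ := Submodule.exists_mem_ne_zero_of_ne_bot hne
  refine ⟨(‖v‖⁻¹ : ℝ) • v, norm_smul_inv_norm hv0, ?_⟩
  set n := (‖v‖⁻¹ : ℝ) • v with hn
  have hn1 : ‖n‖ = 1 := norm_smul_inv_norm hv0
  have hnL : n ∈ L.directionᗮ := Submodule.smul_mem _ _ hv
  obtain ⟨p, hp⟩ := hL.1
  have key : ∀ x, |inner ℝ n (x - p)| ≤ infDist x L := by
    intro x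
    refine (le_infDist hL.1).2 fun y hy => ?_
    have h0 : inner ℝ n (y - p) = 0 :=
      Submodule.inner_left_of_mem_orthogonal (AffineSubspace.vsub_mem_direction hy hp) hnL
    have : x - p = (x - y) + (y - p) := by abel
    rw [this, inner_add_right, h0, add_zero, dist_eq_norm]
    simpa [hn1] using abs_real_inner_le_norm n (x - y)
  intro x y
  have : x - y = (x - p) - (y - p) := by abel
  rw [this, inner_sub_right]
  exact (abs_sub _ _).trans (add_le_add (key x) (key y))

/-- A compact set contained in no proper affine subspace is not near any of them. -/
theorem exists_pos_forall_exists_infDist_lt {K : Set V}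
    (h : ∀ L : AffineSubspace ℝ V, IsProperAffine L → ¬ K ⊆ L) (hne : K.Nonempty) :
    ∃ β, 0 < β ∧ ∀ L : AffineSubspace ℝ V, IsProperAffine L → ∃ x ∈ K, β < infDist x L := by
  -- For one unit `n`, the hyperplane orthogonal to `n` through a point of `K` misses some point of
  -- `K`. This persists for nearby normals, and compactness of the sphere makes it uniform.
  have hsph : ∃ β : ℝ, 0 < β ∧ ∀ n ∈ sphere (0 : V) 1, ∃ x ∈ K, ∃ y ∈ K,
      β < |inner ℝ n (x - y)| := by
    refine (isCompact_sphere (0 : V) 1).induction_on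
      (p := fun S => ∃ β : ℝ, 0 < β ∧ ∀ n ∈ S, ∃ x ∈ K, ∃ y ∈ K, β < |inner ℝ n (x - y)|)
      ⟨1, one_pos, by simp⟩ ?_ ?_ ?_
    · rintro S T hST ⟨β, hβ, H⟩
      exact ⟨β, hβ, fun n hn => H n (hST hn)⟩
    · rintro S T ⟨β, hβ, H⟩ ⟨β', hβ', H'⟩
      refine ⟨min β β', lt_min hβ hβ', ?_⟩
      rintro n (hn | hn)
      · obtain ⟨x, hx, y, hy, hlt⟩ := H n hn
        exact ⟨x, hx, y, hy, (min_le_left _ _).trans_lt hlt⟩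
      · obtain ⟨x, hx, y, hy, hlt⟩ := H' n hn
        exact ⟨x, hx, y, hy, (min_le_right _ _).trans_lt hlt⟩
    · intro n hn
      have hn0 : n ≠ 0 := by
        rintro rfl
        simp at hn
      obtain ⟨p, hp⟩ := hne
      let L : AffineSubspace ℝ V := AffineSubspace.mk' p (ℝ ∙ n)ᗮ
      have hL : IsProperAffine L := by
        refine ⟨⟨p, AffineSubspace.self_mem_mk' _ _⟩, fun hT => hn0 ?_⟩
        have : p + n ∈ L := hT ▸ AffineSubspace.mem_top ℝ V _
        rw [AffineSubspace.mem_mk', vsub_eq_sub, add_sub_cancel_left,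
          Submodule.mem_orthogonal_singleton_iff_inner_right] at this
        exact inner_self_eq_zero.1 this
      obtain ⟨x, hx, hxL⟩ := not_subset.1 (h L hL)
      have hpos : 0 < |inner ℝ n (x - p)| := by
        refine abs_pos.2 fun h0 => hxL ?_
        change x ∈ L
        rwa [AffineSubspace.mem_mk', vsub_eq_sub,
          Submodule.mem_orthogonal_singleton_iff_inner_right]
      have hcont : Continuous fun n' : V => |inner ℝ n' (x - p)| := by fun_prop
      refine ⟨_, mem_nhdsWithin_of_mem_nhds (hcont.continuousAt.preimage_mem_nhds
        (Ioi_mem_nhds (half_lt_self hpos))), |inner ℝ n (x - p)| / 2, half_pos hpos, ?_⟩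
      exact fun n' hn' => ⟨x, hx, p, hp, hn'⟩
  obtain ⟨β, hβ, H⟩ := hsph
  refine ⟨β / 2, half_pos hβ, fun L hL => ?_⟩
  obtain ⟨n, hn, hnL⟩ := hL.exists_normal
  obtain ⟨x, hx, y, hy, hlt⟩ := H n (by simpa using hn)
  by_contra! hcon
  linarith [hcon x hx, hcon y hy, hnL x y]

end Affine

section Euclidean

variable {d : ℕ}

theorem IsHyperplane.isProperAffine {L : AffineSubspace ℝ (EuclideanSpace ℝ (Fin d))}
    (h : IsHyperplane L) : IsProperAffine L := by
  obtain ⟨k, hk, hne, hL⟩ := h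
  refine ⟨hne, ?_⟩
  rintro rfl
  rw [AffineSubspace.direction_top, finrank_top, finrank_euclideanSpace_fin] at hL
  omega

theorem IsProperAffine.exists_hyperplane {L : AffineSubspace ℝ (EuclideanSpace ℝ (Fin d))}
    (h : IsProperAffine L) : ∃ H : AffineSubspace ℝ (EuclideanSpace ℝ (Fin d)),
      IsHyperplane H ∧ L ≤ H := by
  obtain ⟨f, hf, hle⟩ := Submodule.exists_le_ker_of_lt_top _ h.direction_lt_top
  obtain ⟨p, hp⟩ := h.1
  have hfr := Module.Dual.finrank_ker_add_one_of_ne_zero hf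
  rw [finrank_euclideanSpace_fin] at hfr
  refine ⟨AffineSubspace.mk' p (LinearMap.ker f), ⟨_, hfr, ⟨p, AffineSubspace.self_mem_mk' _ _⟩,
    by rw [AffineSubspace.direction_mk']⟩, fun x hx => ?_⟩
  rw [AffineSubspace.mem_mk']
  exact hle (AffineSubspace.vsub_mem_direction hx hp)

/-- Frees the argument from dimension: the span of `K` and the members of an invariant collection
need not be hyperplanes. -/
theorem exists_hyperplane_superset_iff {K : Set (EuclideanSpace ℝ (Fin d))} :
    (∃ H : AffineSubspace ℝ (EuclideanSpace ℝ (Fin d)), IsHyperplane H ∧ K ⊆ (H : Set _)) ↔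
      ∃ L : AffineSubspace ℝ (EuclideanSpace ℝ (Fin d)), IsProperAffine L ∧ K ⊆ (L : Set _) := by
  constructor
  · rintro ⟨H, hH, hK⟩
    exact ⟨H, hH.isProperAffine, hK⟩
  · rintro ⟨L, hL, hK⟩
    obtain ⟨H, hH, hLH⟩ := hL.exists_hyperplane
    exact ⟨H, hH, hK.trans hLH⟩

end Euclidean

/-! ### Affine subspaces under the system, and invariant collections. -/

namespace IsSystem

variable {m : ℕ} {V : Type*} [NormedAddCommGroup V] [InnerProductSpace ℝ V]
  [FiniteDimensional ℝ V] {u : Fin m → V → V} {r : Fin m → ℝ} {K : Set V}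

theorem exists_affineEquiv (h : IsSystem u r K) (w : List (Fin m)) :
    ∃ A : V ≃ᵃ[ℝ] V, ⇑A = wordMap u w :=
  exists_affineEquiv_of_dist_eq (h.ratio_pos w) fun x y => h.dist_wordMap x y w

theorem surjective (h : IsSystem u r K) (w : List (Fin m)) :
    Function.Surjective (wordMap u w) := by
  obtain ⟨A, hA⟩ := h.exists_affineEquiv w
  exact hA ▸ A.surjective

/-- The renormalisation step: closeness to `L` inside a cylinder becomes closeness, at the rescaled
distance, to another proper affine subspace on all of `K`. -/
theorem exists_preimage_affine (h : IsSystem u r K) (w : List (Fin m)) {L : AffineSubspace ℝ V}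
    (hL : IsProperAffine L) : ∃ L' : AffineSubspace ℝ V, IsProperAffine L' ∧
      (L' : Set V) = wordMap u w ⁻¹' L ∧
      ∀ x, wordRatio r w * infDist x L' ≤ infDist (wordMap u w x) L := by
  obtain ⟨A, hA⟩ := h.exists_affineEquiv w
  obtain ⟨L', hL', he⟩ := hL.exists_preimage A
  rw [hA] at he
  refine ⟨L', hL', he, fun x => (le_infDist hL.1).2 fun y hy => ?_⟩
  obtain ⟨z, rfl⟩ := h.surjective w y
  rw [h.dist_wordMap]
  exact mul_le_mul_of_nonneg_left (infDist_le_dist_of_mem (by rw [he]; exact hy)) (h.ratio_pos w).le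

/-- If finitely many proper affine subspaces cover `K`, then one proper affine subspace does. -/
theorem exists_superset_of_subset_biUnion (h : IsSystem u r K)
    {S : Finset (AffineSubspace ℝ V)} (hS : ∀ L ∈ S, IsProperAffine L)
    (hKS : K ⊆ ⋃ L ∈ S, (L : Set V)) :
    ∃ L : AffineSubspace ℝ V, IsProperAffine L ∧ K ⊆ L := by
  have : CompactSpace K := isCompact_iff_compactSpace.1 h.compact
  have : Nonempty K := h.nonempty.to_subtype
  -- Baire category on the compact space `K`.
  obtain ⟨⟨L, hLS⟩, ⟨x, hx⟩, hxi⟩ := nonempty_interior_of_iUnion_of_closed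
    (f := fun L : S => ((↑) : K → V) ⁻¹' (L.1 : Set V))
    (fun L => (L.1.closed_of_finiteDimensional).preimage continuous_subtype_val) (by
      refine eq_univ_of_forall fun x => ?_
      obtain ⟨L, hL, hxL⟩ := mem_iUnion₂.1 (hKS x.2)
      exact mem_iUnion.2 ⟨⟨L, hL⟩, hxL⟩)
  rw [mem_interior_iff_mem_nhds, Metric.mem_nhds_iff] at hxi
  obtain ⟨ε, hε, hball⟩ := hxi
  obtain ⟨c, -, hc⟩ := h.exists_cylinder_subset_closedBall
  have hmin : 0 < min 1 (ε / 2) := by positivity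
  obtain ⟨w, -, hw⟩ := hc x hx _ hmin (min_le_left _ _)
  obtain ⟨L', hL', he, -⟩ := h.exists_preimage_affine w (hS L hLS)
  refine ⟨L', hL', fun y hy => ?_⟩
  rw [he]
  have hy' := h.wordMap_mem w hy
  have hb := mem_closedBall.1 (hw (mem_image_of_mem _ hy))
  have hlt : dist (wordMap u w y) x < ε := by linarith [min_le_right 1 (ε / 2)]
  exact hball (a := ⟨_, hy'⟩) hlt

/-- Each `u i` maps the span into itself, and an injective affine map preserves dimension, so the
inclusion is an equality. -/
theorem affineSpan_invariant (h : IsSystem u r K) (i : Fin m) :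
    u i '' (affineSpan ℝ K : Set V) = affineSpan ℝ K := by
  obtain ⟨A, hA⟩ := h.exists_affineEquiv [i]
  have hA' : ⇑A = u i := by rw [hA]; rfl
  have hle : (affineSpan ℝ K).map (A : V →ᵃ[ℝ] V) ≤ affineSpan ℝ K := by
    rw [AffineSubspace.map_span]
    refine affineSpan_mono ℝ ?_
    change A '' K ⊆ K
    rw [hA']
    exact h.image_subset i
  have heq : (affineSpan ℝ K).map (A : V →ᵃ[ℝ] V) = affineSpan ℝ K := by
    refine AffineSubspace.eq_of_direction_eq_of_nonempty_of_le ?_ ?_ hle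
    · refine Submodule.eq_of_le_of_finrank_eq (AffineSubspace.direction_le hle) ?_
      rw [AffineSubspace.map_direction]
      exact LinearEquiv.finrank_map_eq A.linear _
    · exact (h.nonempty.mono (subset_affineSpan ℝ K)).image A
  conv_rhs => rw [← heq]
  rw [AffineSubspace.coe_map, ← hA']
  rfl

end IsSystem

theorem IsSystem.not_exists_hyperplane_iff {d m : ℕ}
    {u : Fin m → EuclideanSpace ℝ (Fin d) → EuclideanSpace ℝ (Fin d)} {r : Fin m → ℝ}
    {K : Set (EuclideanSpace ℝ (Fin d))} (h : IsSystem u r K) :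
    (¬ ∃ H : AffineSubspace ℝ (EuclideanSpace ℝ (Fin d)), IsHyperplane H ∧ K ⊆ (H : Set _)) ↔
      ¬ ∃ S : Finset (AffineSubspace ℝ (EuclideanSpace ℝ (Fin d))), IsInvariantCollection u S := by
  rw [exists_hyperplane_superset_iff, not_iff_not]
  constructor
  · rintro ⟨L, hL, hKL⟩
    refine ⟨{affineSpan ℝ K}, Finset.singleton_nonempty _, ?_, ?_⟩
    · simp only [Finset.mem_singleton, forall_eq]
      refine ⟨h.nonempty.mono (subset_affineSpan ℝ K), fun hT => hL.2 (top_le_iff.1 ?_)⟩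
      rw [← hT]
      exact affineSpan_le.2 hKL
    · simp only [Finset.mem_singleton, forall_eq, exists_eq_left]
      exact h.affineSpan_invariant
  · rintro ⟨S, ⟨L, hLS⟩, hS, hinv⟩
    obtain ⟨x, hx⟩ := (hS L hLS).1
    have horb := mapsTo_biUnion_wordMap (S := (S : Set (AffineSubspace ℝ _)))
      (c := fun L => (L : Set (EuclideanSpace ℝ (Fin d)))) hinv (mem_iUnion₂.2 ⟨L, hLS, hx⟩)
    refine h.exists_superset_of_subset_biUnion hS (h.subset_of_isClosed_of_mapsTo ?_ horb)
    exact S.finite_toSet.isClosed_biUnion fun L _ => L.closed_of_finiteDimensional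

end SelfSimilar

namespace SelfSimilar

namespace IsSystem

/-! ### Volume count under the open set condition. -/

section Counting

variable {m : ℕ} {V : Type*} [NormedAddCommGroup V] [InnerProductSpace ℝ V]
  [FiniteDimensional ℝ V] {u : Fin m → V → V} {r : Fin m → ℝ} {K : Set V}

theorem ball_subset_image (h : IsSystem u r K) (w : List (Fin m)) (a : V) (ε : ℝ) :
    ball (wordMap u w a) (wordRatio r w * ε) ⊆ wordMap u w '' ball a ε := by
  intro y hy
  obtain ⟨z, rfl⟩ := h.surjective w y
  rw [mem_ball, h.dist_wordMap] at hy
  exact ⟨z, lt_of_mul_lt_mul_left hy (h.ratio_pos w).le, rfl⟩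

/-- Under the open set condition, boundedly many cylinders of size about `ρ` meet a ball of
radius `ρ`. -/
theorem exists_card_le (h : IsSystem u r K) {O : Set V} (hne : O.Nonempty) (hO : IsOpen O)
    (hsub : ∀ i, u i '' O ⊆ O) (hdisj : ∀ i j, i ≠ j → Disjoint (u i '' O) (u j '' O)) :
    ∃ N : ℕ, ∀ x ρ, 0 < ρ → ρ < 1 → ∃ F : Finset (List (Fin m)), F.card ≤ N ∧ ∀ w, w ∈ F ↔
      IsStopping r ρ w ∧ (wordMap u w '' K ∩ closedBall x ρ).Nonempty := by
  obtain ⟨p, hp⟩ := hne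
  obtain ⟨ε, hε, hball⟩ := Metric.isOpen_iff.1 hO p hp
  obtain ⟨a, ha0, ha1, ha⟩ := exists_pos_forall_le h.pos
  obtain ⟨D, hD⟩ := (isBounded_iff.1 (h.compact.isBounded.insert p))
  have hD0 : 0 ≤ D := dist_nonneg.trans (hD (mem_insert p K) (mem_insert p K))
  let _ : MeasurableSpace V := borel V
  have : BorelSpace V := ⟨rfl⟩
  let n := Module.finrank ℝ V
  -- Each cylinder contributes a ball of radius `a * ρ * ε` in its copy of `O`. Its centre is within
  -- `ρ * D` of a point of `closedBall x ρ`, so it lies in `ball x (R * ρ)`. The copies are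
  -- disjoint, so volume bounds their number.
  let R := D + 1 + ε
  have hR : 0 < R := by positivity
  obtain ⟨N, hN⟩ := exists_nat_ge ((R / (a * ε)) ^ n)
  have hcard : ∀ x ρ, 0 < ρ → ρ < 1 → ∀ F : Finset (List (Fin m)), (∀ w ∈ F,
      IsStopping r ρ w ∧ (wordMap u w '' K ∩ closedBall x ρ).Nonempty) → F.card ≤ N := by
    intro x ρ h0 h1 F hF
    let μ : Measure V := Measure.addHaar
    have hsmall : ∀ w ∈ F, ball (wordMap u w p) (a * ρ * ε) ⊆ wordMap u w '' O := fun w hw =>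
      (ball_subset_ball (mul_le_mul_of_nonneg_right
        ((hF w hw).1.le_wordRatio h.pos ha0 ha h0 h1) hε.le)).trans
        ((h.ball_subset_image w p ε).trans (image_mono hball))
    have hbig : ∀ w ∈ F, ball (wordMap u w p) (a * ρ * ε) ⊆ ball x (R * ρ) := by
      intro w hw
      obtain ⟨hs, _, ⟨z, hz, rfl⟩, hzx⟩ := hF w hw
      refine ball_subset_ball' ?_
      have h2 : dist (wordMap u w p) (wordMap u w z) ≤ ρ * D := by
        rw [h.dist_wordMap]
        exact mul_le_mul (hs.wordRatio_le h.pos)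
          (hD (mem_insert p K) (mem_insert_of_mem _ hz)) dist_nonneg h0.le
      have h3 := dist_triangle (wordMap u w p) (wordMap u w z) x
      have h4 := mem_closedBall.1 hzx
      have h5 : a * (ρ * ε) ≤ 1 * (ρ * ε) := mul_le_mul_of_nonneg_right ha1.le (by positivity)
      have h6 : R * ρ = ρ * D + ρ + ρ * ε := by simp only [R]; ring
      linarith
    have hvol : ∑ w ∈ F, μ (ball (wordMap u w p) (a * ρ * ε)) ≤ μ (ball x (R * ρ)) := by
      rw [← measure_biUnion_finset ?_ fun _ _ => measurableSet_ball]
      · exact measure_mono (iUnion₂_subset hbig)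
      · intro v hv w hw hvw
        exact ((hF v hv).1.disjoint_image h.injective hsub hdisj (hF w hw).1 hvw).mono
          (hsmall v hv) (hsmall w hw)
    have hpos : 0 < a * ρ * ε := by positivity
    have hμ0 : μ (ball 0 1) ≠ 0 := (measure_ball_pos μ _ one_pos).ne'
    have hμt : μ (ball 0 1) ≠ ∞ := measure_ball_lt_top.ne
    simp only [Measure.addHaar_ball_of_pos μ _ hpos, Measure.addHaar_ball_of_pos μ _
      (mul_pos hR h0), Finset.sum_const, nsmul_eq_mul, ← mul_assoc] at hvol
    rw [ENNReal.mul_le_mul_iff_left hμ0 hμt, ← ENNReal.ofReal_natCast,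
      ← ENNReal.ofReal_mul (by positivity), ENNReal.ofReal_le_ofReal_iff (by positivity)] at hvol
    have : (F.card : ℝ) ≤ (R / (a * ε)) ^ n := by
      rw [div_pow, le_div_iff₀ (by positivity)]
      refine le_of_mul_le_mul_right ?_ (pow_pos h0 n)
      rw [mul_assoc, ← mul_pow, ← mul_pow, mul_right_comm]
      exact hvol
    exact_mod_cast this.trans hN
  refine ⟨N, fun x ρ h0 h1 => ?_⟩
  have hfin : {w : List (Fin m) | IsStopping r ρ w ∧
      (wordMap u w '' K ∩ closedBall x ρ).Nonempty}.Finite := by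
    by_contra hinf
    obtain ⟨F, hF, hFc⟩ := Set.Infinite.exists_subset_card_eq hinf (N + 1)
    have := hcard x ρ h0 h1 F fun w hw => hF hw
    omega
  exact ⟨hfin.toFinset, hcard x ρ h0 h1 _ fun w hw => (hfin.mem_toFinset.1 hw),
    fun w => hfin.mem_toFinset⟩

end Counting

/-! ### Similarity dimension and Bernoulli measure. -/

section Exponent

/-- The similarity dimension. -/
theorem exists_moran_exponent {m : ℕ} {r : Fin m → ℝ} (hm : 2 ≤ m) (h0 : ∀ i, 0 < r i)
    (h1 : ∀ i, r i < 1) : ∃ s : ℝ, 0 < s ∧ ∑ i, r i ^ s = 1 := by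
  have hcont : Continuous fun s : ℝ => ∑ i, r i ^ s :=
    continuous_finsetSum _ fun i _ => Real.continuous_const_rpow (h0 i).ne'
  have hlim : Tendsto (fun s : ℝ => ∑ i, r i ^ s) atTop (𝓝 0) := by
    have := tendsto_finsetSum (Finset.univ : Finset (Fin m)) fun i _ =>
      tendsto_rpow_atTop_of_base_lt_one (r i) (by linarith [h0 i]) (h1 i)
    simpa using this
  obtain ⟨t, ht, ht0⟩ := ((hlim.eventually (gt_mem_nhds one_pos)).and (eventually_ge_atTop 0)).exists
  have hz : (1 : ℝ) < ∑ i, r i ^ (0 : ℝ) := by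
    simp only [Real.rpow_zero, Finset.sum_const, Finset.card_univ, Fintype.card_fin, nsmul_eq_mul,
      mul_one]
    exact_mod_cast hm
  obtain ⟨s, hs, hs1⟩ := intermediate_value_Icc' ht0 hcont.continuousOn ⟨ht.le, hz.le⟩
  refine ⟨s, hs.1.lt_of_ne ?_, hs1⟩
  rintro rfl
  exact hz.ne' hs1

/-- This is the expansion of `(∑ i, r i ^ s) ^ n`. -/
theorem sum_wordRatio_rpow {m : ℕ} {r : Fin m → ℝ} (h0 : ∀ i, 0 < r i) {s : ℝ}
    (hs : ∑ i, r i ^ s = 1) (n : ℕ) : ∑ p : Fin n → Fin m, wordRatio r (List.ofFn p) ^ s = 1 := by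
  calc _ = ∑ p : Fin n → Fin m, ∏ k, r (p k) ^ s := by
        refine Finset.sum_congr rfl fun p _ => ?_
        rw [wordRatio_ofFn, Real.finsetProd_rpow _ _ fun k _ => (h0 _).le]
    _ = 1 := by rw [← Fintype.sum_pow (fun i => r i ^ s), hs, one_pow]

/-- The Bernoulli measure on infinite words giving every cylinder the mass `wordRatio r w ^ s`. -/
theorem exists_bernoulli {m : ℕ} {s : ℝ} {r : Fin m → ℝ} (h0 : ∀ i, 0 < r i) (hs : ∑ i, r i ^ s = 1) :
    ∃ P : Measure (ℕ → Fin m), IsProbabilityMeasure P ∧ ∀ w : List (Fin m),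
      P {ω | List.ofFn (fun k : Fin w.length => ω k) = w} = ENNReal.ofReal (wordRatio r w ^ s) := by
  have hsum : ∑ i, ENNReal.ofReal (r i ^ s) = 1 := by
    rw [← ENNReal.ofReal_sum_of_nonneg fun i _ => by have := h0 i; positivity, hs,
      ENNReal.ofReal_one]
  let p : PMF (Fin m) := PMF.ofFintype _ hsum
  refine ⟨Measure.infinitePi fun _ => p.toMeasure, inferInstance, fun w => ?_⟩
  -- Optional indexing `w[k]?` makes the factor meaningful for every `k`, as the product over `ℕ`
  -- requires.
  have hset : {ω : ℕ → Fin m | List.ofFn (fun k : Fin w.length => ω k) = w} =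
      Set.pi (Finset.range w.length : Set ℕ) fun k => {i | w[k]? = some i} := by
    ext ω
    simp only [mem_ofPred_eq, List.ext_get_iff, List.length_ofFn, Set.mem_pi, Finset.mem_coe,
      Finset.mem_range, true_and]
    constructor
    · intro H k hk
      simpa [List.getElem?_eq_getElem hk] using (H k hk hk).symm
    · intro H k hk hk'
      simpa [List.getElem?_eq_getElem hk'] using (H k hk').symm
  rw [hset, Measure.infinitePi_pi _ fun _ _ => MeasurableSet.of_discrete, Finset.prod_range,
    wordRatio, ← Real.list_prod_map_rpow' _ _ (fun i _ => (h0 i).le)]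
  have hk : ∀ k : Fin w.length, p.toMeasure {i | w[(k : ℕ)]? = some i} =
      ENNReal.ofReal (r (w.get k) ^ s) := by
    intro k
    have : {i | w[(k : ℕ)]? = some i} = {w.get k} := by
      ext i
      simp [eq_comm]
    rw [this, PMF.toMeasure_apply_singleton _ _ (MeasurableSet.of_discrete), PMF.ofFintype_apply]
  simp only [hk]
  rw [← ENNReal.ofReal_prod_of_nonneg fun k _ => by have := h0 (w.get k); positivity]
  congr 1
  rw [← List.prod_ofFn, List.ofFn_comp' w.get fun i => r i ^ s, List.ofFn_get]

end Exponent

/-! ### Coding infinite words by points. -/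

section Coding

variable {m : ℕ} {X : Type*} [MetricSpace X] {u : Fin m → X → X} {r : Fin m → ℝ} {K : Set X}

theorem ediam_image_le (h : IsSystem u r K) (w : List (Fin m)) {D : ℝ}
    (hD : ∀ x ∈ K, ∀ y ∈ K, dist x y ≤ D) :
    ediam (wordMap u w '' K) ≤ ENNReal.ofReal (wordRatio r w * D) := by
  refine ediam_le ?_
  rintro _ ⟨x, hx, rfl⟩ _ ⟨y, hy, rfl⟩
  rw [edist_dist, h.dist_wordMap]
  exact ENNReal.ofReal_le_ofReal (mul_le_mul_of_nonneg_left (hD x hx y hy) (h.ratio_pos w).le)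

/-- A coding of infinite words by points of `K`, compatible with all stopping words. -/
theorem exists_coding (h : IsSystem u r K) : ∃ π : (ℕ → Fin m) → X, ∀ ω, ∀ ρ : ℝ, 0 < ρ →
    ∃ n : ℕ, IsStopping r ρ (List.ofFn fun k : Fin n => ω k) ∧
      π ω ∈ wordMap u (List.ofFn fun k : Fin n => ω k) '' K := by
  have hprefix : ∀ ρ : ℝ, 0 < ρ → ∀ ω : ℕ → Fin m,
      ∃ n : ℕ, IsStopping r ρ (List.ofFn fun k : Fin n => ω k) := by
    obtain ⟨b, hb0, hb1, hb⟩ := exists_lt_one_forall_le h.lt_one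
    intro ρ hρ
    obtain ⟨n, hn⟩ := exists_pow_lt_of_lt_one hρ hb1
    induction n generalizing ρ with
    | zero => exact fun ω => ⟨0, by simpa [IsStopping] using hn.le⟩
    | succ n ih =>
      intro ω
      by_cases h1 : 1 ≤ ρ
      · exact ⟨0, by simpa [IsStopping] using h1⟩
      obtain ⟨k, hk⟩ := ih (ρ / r (ω 0)) (div_pos hρ (h.pos _)) (by
        rw [lt_div_iff₀ (h.pos _)]
        refine lt_of_le_of_lt ?_ hn
        rw [pow_succ]
        exact mul_le_mul_of_nonneg_left (hb _) (by positivity)) fun k => ω (k + 1)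
      exact ⟨k + 1, by simpa [IsStopping, List.ofFn_succ] using ⟨not_le.1 h1, hk⟩⟩
  -- The cylinders of the prefixes of `ω` are nested nonempty compact sets.
  have hpt : ∀ ω : ℕ → Fin m, (⋂ n : ℕ, wordMap u (List.ofFn fun k : Fin n => ω k) '' K).Nonempty := by
    intro ω
    have hcont : ∀ w, Continuous (wordMap u w) := fun w =>
      (LipschitzWith.of_dist_le_mul (K := (wordRatio r w).toNNReal) fun x y => by
        rw [h.dist_wordMap, Real.coe_toNNReal _ (h.ratio_pos w).le]).continuous
    refine IsCompact.nonempty_iInter_of_sequence_nonempty_isCompact_isClosed _ ?_ ?_ ?_ ?_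
    · intro n
      have : ∀ (n : ℕ) (ω : ℕ → Fin m), wordMap u (List.ofFn fun k : Fin (n + 1) => ω k) '' K ⊆
          wordMap u (List.ofFn fun k : Fin n => ω k) '' K := by
        intro n
        induction n with
        | zero =>
          intro ω
          simpa [List.ofFn_succ] using h.image_subset (ω 0)
        | succ n ih =>
          intro ω
          rw [List.ofFn_succ, wordMap_cons, image_comp]
          conv_rhs => rw [List.ofFn_succ, wordMap_cons, image_comp]
          exact image_mono (ih fun k => ω (k + 1))
      exact this n ω
    · exact fun n => h.nonempty.image _
    · exact h.compact.image (hcont _)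
    · exact fun n => (h.compact.image (hcont _)).isClosed
  choose π hπ using hpt
  refine ⟨π, fun ω ρ hρ => ?_⟩
  obtain ⟨n, hn⟩ := hprefix ρ hρ ω
  exact ⟨n, hn, mem_iInter.1 (hπ ω) n⟩

end Coding

/-! ### The Hausdorff measure of `K` is finite and positive. -/

section Hausdorff

variable {m : ℕ} {X : Type*} [MetricSpace X] [MeasurableSpace X] [BorelSpace X]
  {u : Fin m → X → X} {r : Fin m → ℝ} {K : Set X} {s : ℝ}

theorem hausdorffMeasure_image_le (h : IsSystem u r K) (hs : 0 ≤ s) (w : List (Fin m))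
    (A : Set X) :
    μH[s] (wordMap u w '' A) ≤ ENNReal.ofReal (wordRatio r w ^ s) * μH[s] A := by
  have hl : LipschitzWith (wordRatio r w).toNNReal (wordMap u w) :=
    LipschitzWith.of_dist_le_mul fun x y => by
      rw [h.dist_wordMap, Real.coe_toNNReal _ (h.ratio_pos w).le]
  have := hl.hausdorffMeasure_image_le hs A
  rwa [← ENNReal.ofReal, ENNReal.ofReal_rpow_of_pos (h.ratio_pos w)] at this

theorem hausdorffMeasure_image (h : IsSystem u r K) (hs : 0 ≤ s) (w : List (Fin m))
    (A : Set X) :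
    μH[s] (wordMap u w '' A) = ENNReal.ofReal (wordRatio r w ^ s) * μH[s] A := by
  refine le_antisymm (h.hausdorffMeasure_image_le hs w A) ?_
  have hpos := h.ratio_pos w
  have hl : AntilipschitzWith (wordRatio r w)⁻¹.toNNReal (wordMap u w) :=
    AntilipschitzWith.of_le_mul_dist fun x y => by
      rw [h.dist_wordMap, Real.coe_toNNReal _ (by positivity), inv_mul_cancel_left₀ hpos.ne']
  have := hl.le_hausdorffMeasure_image hs A
  rw [← ENNReal.ofReal, ENNReal.ofReal_rpow_of_pos (by positivity)] at this
  calc _ ≤ ENNReal.ofReal (wordRatio r w ^ s) *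
        (ENNReal.ofReal ((wordRatio r w)⁻¹ ^ s) * μH[s] (wordMap u w '' A)) := by gcongr
    _ = _ := by
      rw [← mul_assoc, ← ENNReal.ofReal_mul (by positivity), ← Real.mul_rpow hpos.le
        (by positivity), mul_inv_cancel₀ hpos.ne', Real.one_rpow, ENNReal.ofReal_one, one_mul]

/-- The cylinders of length `n` have diameters at most their ratios times `D`, and the `s`-th powers
of the ratios sum to `1`, so every level costs at most `D ^ s`. -/
theorem hausdorffMeasure_ne_top (h : IsSystem u r K) (hs0 : 0 ≤ s) (hs : ∑ i, r i ^ s = 1) :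
    μH[s] K ≠ ∞ := by
  obtain ⟨D, hD1, hD⟩ := h.exists_diam_bound
  obtain ⟨b, hb0, hb1, hb⟩ := exists_lt_one_forall_le h.lt_one
  have hlim : Tendsto (fun n : ℕ => ENNReal.ofReal (b ^ n * D)) atTop (𝓝 0) := by
    rw [← ENNReal.ofReal_zero, ← zero_mul D]
    exact ENNReal.tendsto_ofReal ((tendsto_pow_atTop_nhds_zero_of_lt_one hb0.le hb1).mul_const D)
  have hle := Measure.hausdorffMeasure_le_liminf_sum (ι := fun n => Fin n → Fin m) s K
    (l := atTop) _ hlim (fun n p => wordMap u (List.ofFn p) '' K)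
    (Eventually.of_forall fun n p => (h.ediam_image_le _ hD).trans (ENNReal.ofReal_le_ofReal
      (mul_le_mul_of_nonneg_right (wordRatio_ofFn_le (fun i => (h.pos i).le) hb p)
        (by linarith)))) (Eventually.of_forall h.subset_iUnion_ofFn)
  refine ne_top_of_le_ne_top (ENNReal.ofReal_ne_top (r := D ^ s)) (hle.trans ?_)
  refine liminf_le_of_le (by isBoundedDefault) fun c hc => ?_
  obtain ⟨n, hn⟩ := hc.exists
  refine hn.trans ?_
  calc _ ≤ ∑ p : Fin n → Fin m, ENNReal.ofReal (wordRatio r (List.ofFn p) ^ s * D ^ s) := by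
        refine Finset.sum_le_sum fun p _ => ?_
        have hp := h.ratio_pos (List.ofFn p)
        rw [← Real.mul_rpow hp.le (by linarith), ← ENNReal.ofReal_rpow_of_pos (by positivity)]
        exact ENNReal.rpow_le_rpow (h.ediam_image_le _ hD) hs0
    _ = ENNReal.ofReal (D ^ s) := by
        rw [← ENNReal.ofReal_sum_of_nonneg fun p _ => by
          have := h.ratio_pos (List.ofFn p); positivity, ← Finset.sum_mul,
          sum_wordRatio_rpow h.pos hs, one_mul]

/-- The mass distribution principle for the Bernoulli measure on words. -/
theorem hausdorffMeasure_ne_zero (h : IsSystem u r K) (hs0 : 0 < s) (hs : ∑ i, r i ^ s = 1) {N : ℕ}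
    (hN : ∀ x ρ, 0 < ρ → ρ < 1 → ∃ F : Finset (List (Fin m)), F.card ≤ N ∧ ∀ w, w ∈ F ↔
      IsStopping r ρ w ∧ (wordMap u w '' K ∩ closedBall x ρ).Nonempty) : μH[s] K ≠ 0 := by
  obtain ⟨P, hP, hPw⟩ := exists_bernoulli h.pos hs
  obtain ⟨π, hπ⟩ := h.exists_coding
  have hcover : ∀ x ρ, 0 < ρ → ρ < 1 → P (π ⁻¹' closedBall x ρ) ≤ N * ENNReal.ofReal (ρ ^ s) := by
    intro x ρ h0 h1
    obtain ⟨F, hFc, hF⟩ := hN x ρ h0 h1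
    calc P (π ⁻¹' closedBall x ρ)
        ≤ P (⋃ w ∈ F, {ω | List.ofFn (fun k : Fin w.length => ω k) = w}) := by
          refine measure_mono fun ω hω => ?_
          obtain ⟨n, hn, hmem⟩ := hπ ω ρ h0
          refine mem_iUnion₂.2 ⟨_, (hF _).2 ⟨hn, _, hmem, hω⟩, ?_⟩
          simp [List.ext_get_iff]
      _ ≤ ∑ w ∈ F, P {ω | List.ofFn (fun k : Fin w.length => ω k) = w} :=
          measure_biUnion_finset_le _ _
      _ ≤ ∑ _w ∈ F, ENNReal.ofReal (ρ ^ s) := by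
          refine Finset.sum_le_sum fun w hw => ?_
          rw [hPw]
          exact ENNReal.ofReal_le_ofReal (Real.rpow_le_rpow (h.ratio_pos w).le
            (((hF w).1 hw).1.wordRatio_le h.pos) hs0.le)
      _ ≤ N * ENNReal.ofReal (ρ ^ s) := by
          rw [Finset.sum_const, nsmul_eq_mul]
          gcongr
  -- `A` lies in balls of every radius above its diameter; letting the radius decrease also covers
  -- diameter `0`. The constant `N + 1` is nonzero even if `N = 0`.
  have hdiam : ∀ A : Set X, ediam A ≤ 1 / 2 → P (π ⁻¹' A) ≤ (N + 1 : ℝ≥0∞) * ediam A ^ s := by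
    intro A hA
    obtain rfl | ⟨x, hx⟩ := A.eq_empty_or_nonempty
    · simp
    have hAt : ediam A ≠ ∞ := ne_top_of_le_ne_top (by simp) hA
    have hlt : (ediam A).toReal < 1 := by
      have := ENNReal.toReal_mono (by simp) hA
      norm_num at this
      linarith
    have hlim : Tendsto (fun ρ : ℝ => (N : ℝ≥0∞) * ENNReal.ofReal (ρ ^ s))
        (𝓝[>] (ediam A).toReal) (𝓝 (N * ENNReal.ofReal ((ediam A).toReal ^ s))) := by
      refine ENNReal.Tendsto.const_mul (ENNReal.tendsto_ofReal ?_)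
        (Or.inr (ENNReal.natCast_ne_top N))
      exact ((Real.continuous_rpow_const hs0.le).tendsto _).mono_left nhdsWithin_le_nhds
    have hle : P (π ⁻¹' A) ≤ N * ENNReal.ofReal ((ediam A).toReal ^ s) := by
      refine ge_of_tendsto hlim ?_
      filter_upwards [self_mem_nhdsWithin, nhdsWithin_le_nhds (Iio_mem_nhds hlt)] with ρ h1 h2
      refine (measure_mono (preimage_mono fun y hy => ?_)).trans
        (hcover x ρ (ENNReal.toReal_nonneg.trans_lt h1) h2)
      rw [mem_closedBall, dist_edist]
      exact (ENNReal.toReal_mono hAt (edist_le_ediam_of_mem hy hx)).trans (le_of_lt h1)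
    rw [← ENNReal.ofReal_rpow_of_nonneg ENNReal.toReal_nonneg hs0.le, ENNReal.ofReal_toReal hAt]
      at hle
    exact hle.trans (mul_le_mul_left le_self_add _)
  -- The comparison is between outer measures because `π` is not known to be measurable.
  have hmk : (N + 1 : ℝ≥0∞)⁻¹ • OuterMeasure.map π P.toOuterMeasure ≤
      OuterMeasure.mkMetric fun t => t ^ s := by
    refine OuterMeasure.le_mkMetric _ _ (1 / 2) (by simp) fun A hA => ?_
    rw [smul_apply, OuterMeasure.map_apply, smul_eq_mul,
      ENNReal.inv_mul_le_iff (by simp) (by simp)]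
    exact hdiam A hA
  have hKP : P (π ⁻¹' K) = 1 := by
    rw [show π ⁻¹' K = univ from eq_univ_of_forall fun ω => ?_, measure_univ]
    obtain ⟨n, -, y, hy, he⟩ := hπ ω 1 one_pos
    exact mem_preimage.2 (he ▸ h.wordMap_mem _ hy)
  have := hmk K
  rw [smul_apply, OuterMeasure.map_apply, smul_eq_mul, OuterMeasure.coe_mkMetric] at this
  change (N + 1 : ℝ≥0∞)⁻¹ * P (π ⁻¹' K) ≤ μH[s] K at this
  rw [hKP, mul_one] at this
  exact (lt_of_lt_of_le (by simp) this).ne'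

end Hausdorff

end IsSystem

end SelfSimilar

namespace SelfSimilar

namespace IsSystem

/-! ### Measure of balls. -/

section Ahlfors

variable {m : ℕ} {X : Type*} [MetricSpace X] [MeasurableSpace X] [BorelSpace X]
  {u : Fin m → X → X} {r : Fin m → ℝ} {K : Set X} {s : ℝ}

/-- One cylinder of comparable size inside the ball suffices, by scaling. -/
theorem exists_le_hausdorffMeasure_closedBall (h : IsSystem u r K) (hs0 : 0 ≤ s) :
    ∃ c, 0 < c ∧ ∀ x ∈ K, ∀ ρ, 0 < ρ → ρ ≤ 1 →
      ENNReal.ofReal (c * ρ ^ s) * μH[s] K ≤ μH[s] (closedBall x ρ ∩ K) := by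
  obtain ⟨c, hc0, hc⟩ := h.exists_cylinder_subset_closedBall
  refine ⟨c ^ s, by positivity, fun x hx ρ h0 h1 => ?_⟩
  obtain ⟨w, hw, hsub⟩ := hc x hx ρ h0 h1
  calc _ ≤ ENNReal.ofReal (wordRatio r w ^ s) * μH[s] K := by
        rw [← Real.mul_rpow hc0.le h0.le]
        gcongr
    _ = μH[s] (wordMap u w '' K) := (h.hausdorffMeasure_image hs0 w K).symm
    _ ≤ _ := measure_mono (subset_inter hsub (image_wordMap_subset h.image_subset w))

/-- Serves twice: `T = univ` gives the upper Ahlfors bound, and a neighbourhood of a hyperplane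
gives decay. -/
theorem hausdorffMeasure_closedBall_inter_le (h : IsSystem u r K) (hs0 : 0 ≤ s) {x : X} {ρ : ℝ}
    (hρ : 0 < ρ) {F : Finset (List (Fin m))}
    (hF : ∀ w, IsStopping r ρ w → (wordMap u w '' K ∩ closedBall x ρ).Nonempty → w ∈ F)
    (T : Set X) : μH[s] (closedBall x ρ ∩ T ∩ K) ≤
      ∑ w ∈ F, ENNReal.ofReal (wordRatio r w ^ s) * μH[s] (K ∩ wordMap u w ⁻¹' T) := by
  calc _ ≤ μH[s] (⋃ w ∈ F, wordMap u w '' (K ∩ wordMap u w ⁻¹' T)) := by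
        refine measure_mono ?_
        rintro y ⟨⟨hyB, hyT⟩, hyK⟩
        obtain ⟨w, hw, z, hz, rfl⟩ := h.exists_isStopping hρ hyK
        exact mem_iUnion₂.2 ⟨w, hF w hw ⟨_, mem_image_of_mem _ hz, hyB⟩, z, ⟨hz, hyT⟩, rfl⟩
    _ ≤ ∑ w ∈ F, μH[s] (wordMap u w '' (K ∩ wordMap u w ⁻¹' T)) := measure_biUnion_finset_le _ _
    _ ≤ _ := Finset.sum_le_sum fun w _ => h.hausdorffMeasure_image_le hs0 w _

theorem hausdorffMeasure_closedBall_le (h : IsSystem u r K) (hs0 : 0 ≤ s) {N : ℕ} {x : X} {ρ : ℝ}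
    (hρ : 0 < ρ) {F : Finset (List (Fin m))} (hFc : F.card ≤ N)
    (hF : ∀ w, w ∈ F ↔ IsStopping r ρ w ∧ (wordMap u w '' K ∩ closedBall x ρ).Nonempty) :
    μH[s] (closedBall x ρ ∩ K) ≤ ENNReal.ofReal (N * ρ ^ s) * μH[s] K := by
  have := h.hausdorffMeasure_closedBall_inter_le hs0 hρ
    (fun w h1 h2 => (hF w).2 ⟨h1, h2⟩) univ
  simp only [inter_univ, preimage_univ] at this
  refine this.trans ?_
  calc _ ≤ ∑ _w ∈ F, ENNReal.ofReal (ρ ^ s) * μH[s] K := by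
        refine Finset.sum_le_sum fun w hw => ?_
        have := ((hF w).1 hw).1.wordRatio_le h.pos
        have := (h.ratio_pos w).le
        gcongr
    _ = F.card * (ENNReal.ofReal (ρ ^ s) * μH[s] K) := by rw [Finset.sum_const, nsmul_eq_mul]
    _ ≤ N * (ENNReal.ofReal (ρ ^ s) * μH[s] K) := by gcongr
    _ = _ := by rw [ENNReal.ofReal_mul (by positivity), ENNReal.ofReal_natCast, mul_assoc]

end Ahlfors

/-! ### Decay near affine subspaces. -/

section Decay

variable {m : ℕ} {V : Type*} [NormedAddCommGroup V] [InnerProductSpace ℝ V]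
  [FiniteDimensional ℝ V] {u : Fin m → V → V} {r : Fin m → ℝ} {K : Set V} {s : ℝ}

/-- A neighbourhood of an affine subspace misses a cylinder of fixed level. -/
theorem exists_cylinder_lt_infDist (h : IsSystem u r K)
    (hK : ∀ L : AffineSubspace ℝ V, IsProperAffine L → ¬ K ⊆ L) :
    ∃ (β : ℝ) (n : ℕ), 0 < β ∧ ∀ L : AffineSubspace ℝ V, IsProperAffine L →
      ∃ p : Fin (n + 1) → Fin m, ∀ x ∈ wordMap u (List.ofFn p) '' K, β < infDist x L := by
  obtain ⟨β, hβ, H⟩ := exists_pos_forall_exists_infDist_lt hK h.nonempty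
  obtain ⟨D, hD1, hD⟩ := h.exists_diam_bound
  obtain ⟨b, hb0, hb1, hb⟩ := exists_lt_one_forall_le h.lt_one
  -- Cylinders of this level have diameter at most `β / 2`, so one containing a point at distance
  -- above `β` stays `β / 2` away. Level `n + 1` is nonzero, which later makes `q < 1`.
  obtain ⟨n, hn⟩ := exists_pow_lt_of_lt_one (show 0 < β / 2 / D by positivity) hb1
  refine ⟨β / 2, n, half_pos hβ, fun L hL => ?_⟩
  obtain ⟨x, hx, hlt⟩ := H L hL
  obtain ⟨p, y, hy, rfl⟩ := mem_iUnion.1 (h.subset_iUnion_ofFn (n + 1) hx)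
  refine ⟨p, ?_⟩
  rintro _ ⟨z, hz, rfl⟩
  have h1 : dist (wordMap u (List.ofFn p) y) (wordMap u (List.ofFn p) z) ≤ β / 2 := by
    rw [h.dist_wordMap]
    calc _ ≤ (β / 2 / D) * D := by
          refine mul_le_mul ?_ (hD y hy z hz) dist_nonneg (by positivity)
          refine (wordRatio_ofFn_le (fun i => (h.pos i).le) hb p).trans (le_trans ?_ hn.le)
          exact pow_le_pow_of_le_one hb0.le hb1.le n.le_succ
      _ = β / 2 := by field_simp
  have h2 := infDist_le_infDist_add_dist (s := (L : Set V)) (x := wordMap u (List.ofFn p) y)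
    (y := wordMap u (List.ofFn p) z)
  linarith

variable [MeasurableSpace V] [BorelSpace V]

/-- The neighbourhood misses a cylinder of weight at least `q ^ s`. In each other cylinder, pulling
back enlarges `ε` by at most `1 / q` and changes `L`, hence the induction over all `L` at once.
Subadditivity suffices, so no separation is needed. -/
theorem hausdorffMeasure_nhd_iterate (h : IsSystem u r K) (hs0 : 0 < s) (hs : ∑ i, r i ^ s = 1)
    {β q : ℝ} {n : ℕ} (hq0 : 0 < q) (hq1 : q < 1)
    (hq : ∀ p : Fin n → Fin m, q ≤ wordRatio r (List.ofFn p))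
    (hβ : ∀ L : AffineSubspace ℝ V, IsProperAffine L →
      ∃ p : Fin n → Fin m, ∀ x ∈ wordMap u (List.ofFn p) '' K, β < infDist x L) (k : ℕ) :
    ∀ L : AffineSubspace ℝ V, IsProperAffine L → ∀ ε, 0 ≤ ε → ε ≤ β * q ^ k →
      μH[s] (K ∩ {x | infDist x L ≤ ε}) ≤ ENNReal.ofReal ((1 - q ^ s) ^ k) * μH[s] K := by
  have hqs : q ^ s < 1 := Real.rpow_lt_one hq0.le hq1 hs0
  induction k with
  | zero =>
    intro L _ ε _ _
    simpa using measure_mono inter_subset_left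
  | succ k ih =>
    intro L hL ε hε0 hε
    have hβ0 : 0 ≤ β := by
      by_contra! hneg
      have := mul_neg_of_neg_of_pos hneg (pow_pos hq0 (k + 1))
      linarith
    have hεβ : ε ≤ β :=
      hε.trans (mul_le_of_le_one_right hβ0 (pow_le_one₀ hq0.le hq1.le))
    obtain ⟨p₀, hp₀⟩ := hβ L hL
    classical
    have hcov : K ∩ {x | infDist x L ≤ ε} ⊆ ⋃ p ∈ Finset.univ.erase p₀,
        wordMap u (List.ofFn p) '' (K ∩ {y | infDist (wordMap u (List.ofFn p) y) L ≤ ε}) := by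
      rintro x ⟨hxK, hx⟩
      obtain ⟨p, y, hy, rfl⟩ := mem_iUnion.1 (h.subset_iUnion_ofFn n hxK)
      refine mem_iUnion₂.2 ⟨p, Finset.mem_erase.2 ⟨?_, Finset.mem_univ _⟩, y, ⟨hy, hx⟩, rfl⟩
      rintro rfl
      exact (hεβ.trans_lt (hp₀ _ (mem_image_of_mem _ hy))).not_ge hx
    have hpiece : ∀ p : Fin n → Fin m, μH[s] (wordMap u (List.ofFn p) ''
        (K ∩ {y | infDist (wordMap u (List.ofFn p) y) L ≤ ε})) ≤
        ENNReal.ofReal (wordRatio r (List.ofFn p) ^ s) *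
          (ENNReal.ofReal ((1 - q ^ s) ^ k) * μH[s] K) := by
      intro p
      refine (h.hausdorffMeasure_image_le hs0.le _ _).trans ?_
      gcongr
      have hpos := h.ratio_pos (List.ofFn p)
      obtain ⟨L', hL', -, hd⟩ := h.exists_preimage_affine (List.ofFn p) hL
      refine (measure_mono (inter_subset_inter_right K fun y hy => ?_)).trans
        (ih L' hL' (ε / wordRatio r (List.ofFn p)) (by positivity) ?_)
      · exact (le_div_iff₀' hpos).2 ((hd y).trans hy)
      · rw [div_le_iff₀ hpos]
        calc ε ≤ β * q ^ k * q := by rw [mul_assoc, ← pow_succ]; exact hε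
          _ ≤ _ := mul_le_mul_of_nonneg_left (hq p) (by positivity)
    have hsum : ∑ p ∈ Finset.univ.erase p₀, wordRatio r (List.ofFn p) ^ s ≤ 1 - q ^ s := by
      have h1 := Finset.add_sum_erase Finset.univ
        (fun p : Fin n → Fin m => wordRatio r (List.ofFn p) ^ s) (Finset.mem_univ p₀)
      rw [sum_wordRatio_rpow h.pos hs] at h1
      have h2 := Real.rpow_le_rpow hq0.le (hq p₀) hs0.le
      linarith
    calc _ ≤ ∑ p ∈ Finset.univ.erase p₀, ENNReal.ofReal (wordRatio r (List.ofFn p) ^ s) *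
          (ENNReal.ofReal ((1 - q ^ s) ^ k) * μH[s] K) :=
          (measure_mono hcov).trans ((measure_biUnion_finset_le _ _).trans
            (Finset.sum_le_sum fun p _ => hpiece p))
      _ = ENNReal.ofReal (∑ p ∈ Finset.univ.erase p₀, wordRatio r (List.ofFn p) ^ s) *
          (ENNReal.ofReal ((1 - q ^ s) ^ k) * μH[s] K) := by
          rw [← Finset.sum_mul, ENNReal.ofReal_sum_of_nonneg fun p _ => by
            have := h.ratio_pos (List.ofFn p); positivity]
      _ ≤ ENNReal.ofReal (1 - q ^ s) * (ENNReal.ofReal ((1 - q ^ s) ^ k) * μH[s] K) := by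
          gcongr
      _ = _ := by
          rw [← mul_assoc, ← ENNReal.ofReal_mul (by linarith), ← pow_succ']

theorem exists_hausdorffMeasure_nhd_le (h : IsSystem u r K) (hs0 : 0 < s) (hs : ∑ i, r i ^ s = 1)
    (hK : ∀ L : AffineSubspace ℝ V, IsProperAffine L → ¬ K ⊆ L) :
    ∃ C γ : ℝ, 0 < C ∧ 0 < γ ∧ ∀ L : AffineSubspace ℝ V, IsProperAffine L → ∀ ε, 0 < ε →
      μH[s] (K ∩ {x | infDist x L ≤ ε}) ≤ ENNReal.ofReal (C * ε ^ γ) * μH[s] K := by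
  obtain ⟨β, n, hβ, H⟩ := h.exists_cylinder_lt_infDist hK
  obtain ⟨a, ha0, ha1, ha⟩ := exists_pos_forall_le h.pos
  have hq0 : 0 < a ^ (n + 1) := by positivity
  have hq1 : a ^ (n + 1) < 1 := pow_lt_one₀ ha0.le ha1 n.succ_ne_zero
  have hiter := h.hausdorffMeasure_nhd_iterate hs0 hs hq0 hq1 (le_wordRatio_ofFn ha0.le ha) H
  generalize a ^ (n + 1) = q at *
  have hl0 : 0 < 1 - q ^ s := sub_pos.2 (Real.rpow_lt_one hq0.le hq1 hs0)
  have hl1 : 1 - q ^ s < 1 := sub_lt_self _ (Real.rpow_pos_of_pos hq0 s)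
  let γ := Real.logb q (1 - q ^ s)
  have hγ : 0 < γ := Real.logb_pos_of_base_lt_one hq0 hq1 hl0 hl1
  have hqγ : q ^ γ = 1 - q ^ s := Real.rpow_logb hq0 hq1.ne hl0
  -- If `q ^ (k + 1) < ε / β ≤ q ^ k`, then `(1 - q ^ s) ^ k = (q ^ k) ^ γ` is at most `(ε / (β *
  -- q)) ^ γ`. For `ε > β` this quantity is at least `1` and the bound is trivial.
  refine ⟨(β * q)⁻¹ ^ γ, γ, by positivity, hγ, fun L hL ε hε => ?_⟩
  rw [← Real.mul_rpow (by positivity) hε.le]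
  by_cases hεβ : ε ≤ β
  · obtain ⟨k, hk1, hk2⟩ := exists_nat_pow_near_of_lt_one (div_pos hε hβ)
      ((div_le_one hβ).2 hεβ) hq0 hq1
    rw [div_le_iff₀' hβ] at hk2
    refine (hiter k L hL ε hε.le hk2).trans ?_
    gcongr
    rw [← hqγ, ← Real.rpow_natCast, ← Real.rpow_mul hq0.le, mul_comm, Real.rpow_mul hq0.le,
      Real.rpow_natCast]
    refine Real.rpow_le_rpow (by positivity) ?_ hγ.le
    rw [pow_succ, lt_div_iff₀ hβ] at hk1
    rw [← div_eq_inv_mul, le_div_iff₀ (by positivity)]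
    linarith
  · refine (measure_mono inter_subset_left).trans ?_
    conv_lhs => rw [← one_mul (μH[s] K)]
    gcongr
    rw [← ENNReal.ofReal_one]
    refine ENNReal.ofReal_le_ofReal (Real.one_le_rpow ?_ hγ.le)
    rw [← div_eq_inv_mul, le_div_iff₀ (by positivity)]
    nlinarith

end Decay

end IsSystem

/-! ### Diffuseness and assembly of the measure estimates. -/

section Euclidean

variable {d m : ℕ} {u : Fin m → EuclideanSpace ℝ (Fin d) → EuclideanSpace ℝ (Fin d)}
  {r : Fin m → ℝ} {K : Set (EuclideanSpace ℝ (Fin d))} {s : ℝ}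

namespace IsSystem

/-- Inside a cylinder of ratio at least `c * ρ`, the uniform gap `β` for the pulled-back subspace
becomes `c * β * ρ`. The minimum with `1 / 2` only keeps the constant below `1`. -/
theorem isHyperplaneDiffuse (h : IsSystem u r K) (hd : 1 ≤ d)
    (hK : ∀ L : AffineSubspace ℝ (EuclideanSpace ℝ (Fin d)), IsProperAffine L → ¬ K ⊆ L) :
    IsHyperplaneDiffuse K := by
  obtain ⟨β, hβ, H⟩ := exists_pos_forall_exists_infDist_lt hK h.nonempty
  obtain ⟨c, hc0, hc⟩ := h.exists_cylinder_subset_closedBall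
  refine ⟨d - 1, by omega, min (1 / 2) (c * β), by positivity,
    (min_le_left _ _).trans_lt (by norm_num), h.compact.isClosed, 1, one_pos,
    fun ρ h0 h1 x hx L hL => ?_⟩
  have hLp : IsProperAffine L := IsHyperplane.isProperAffine ⟨d - 1, by omega, hL⟩
  obtain ⟨w, hw, hsub⟩ := hc x hx ρ h0 h1
  obtain ⟨L', hL', -, hdist⟩ := h.exists_preimage_affine w hLp
  obtain ⟨y, hy, hlt⟩ := H L' hL'
  refine ⟨_, h.wordMap_mem w hy, hsub (mem_image_of_mem _ hy), ?_⟩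
  rw [mem_cthickening_iff_infDist_le hLp.1 (by positivity), not_le]
  calc min (1 / 2) (c * β) * ρ ≤ c * β * ρ := by gcongr; exact min_le_right _ _
    _ = (c * ρ) * β := by ring
    _ < wordRatio r w * infDist y L' := mul_lt_mul' hw hlt hβ.le (h.ratio_pos w)
    _ ≤ _ := hdist y

/-- All measure-theoretic conclusions, in the similarity dimension `s`. -/
theorem regular_of_openSetCondition (h : IsSystem u r K) (hs0 : 0 < s) (hs : ∑ i, r i ^ s = 1)
    (hO : OpenSetCondition u)
    (hK : ∀ L : AffineSubspace ℝ (EuclideanSpace ℝ (Fin d)), IsProperAffine L → ¬ K ⊆ L) :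
    dimH K = ENNReal.ofReal s ∧ ((μH[s]).restrict K).support = K ∧
      IsAhlforsRegular s ((μH[s]).restrict K) ∧ IsAbsolutelyDecaying ((μH[s]).restrict K) := by
  obtain ⟨O, hne, hOo, hsub, hdisj⟩ := hO
  obtain ⟨N, hN⟩ := h.exists_card_le hne hOo hsub hdisj
  have htop := h.hausdorffMeasure_ne_top hs0.le hs
  have hzero := h.hausdorffMeasure_ne_zero hs0 hs hN
  obtain ⟨c, hc0, hc⟩ := h.exists_le_hausdorffMeasure_closedBall hs0.le
  obtain ⟨C, γ, hC0, hγ, hC⟩ := h.exists_hausdorffMeasure_nhd_le hs0 hs hK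
  obtain ⟨a, ha0, ha1, ha⟩ := exists_pos_forall_le h.pos
  have hM0 : 0 < (μH[s] K).toReal := ENNReal.toReal_pos hzero htop
  have hM : ENNReal.ofReal (μH[s] K).toReal = μH[s] K := ENNReal.ofReal_toReal htop
  have hball : ∀ x ρ, (μH[s]).restrict K (closedBall x ρ) = μH[s] (closedBall x ρ ∩ K) :=
    fun x ρ => Measure.restrict_apply measurableSet_closedBall
  have hballpos : ∀ x ∈ K, ∀ ρ, 0 < ρ → ρ ≤ 1 → μH[s] (closedBall x ρ ∩ K) ≠ 0 := by
    intro x hx ρ h0 h1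
    refine (lt_of_lt_of_le ?_ (hc x hx ρ h0 h1)).ne'
    exact ENNReal.mul_pos (ENNReal.ofReal_pos.2 (by positivity)).ne' hzero
  have hfin : IsFiniteMeasure ((μH[s]).restrict K) :=
    ⟨by rw [Measure.restrict_apply_univ]; exact htop.lt_top⟩
  have hsupp : ((μH[s]).restrict K).support = K := by
    refine Subset.antisymm ?_ fun x hx => ?_
    · exact Measure.support_subset_of_isClosed h.compact.isClosed
        (ae_restrict_mem h.compact.isClosed.measurableSet)
    · rw [Measure.mem_support_iff_forall]
      intro U hU
      obtain ⟨ε, hε, hεU⟩ := nhds_basis_closedBall.mem_iff.1 hU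
      have hmin : 0 < min ε 1 := by positivity
      refine lt_of_lt_of_le (pos_iff_ne_zero.2 (hballpos x hx _ hmin (min_le_right _ _))) ?_
      rw [← hball]
      exact measure_mono ((closedBall_subset_closedBall (min_le_left _ _)).trans hεU)
  -- The summand in `N + 1` keeps that constant positive; the final `+ 1` in the decay constant
  -- makes the inequality strict.
  refine ⟨?_, hsupp, ⟨inferInstance, c * (μH[s] K).toReal, (N + 1) * (μH[s] K).toReal, 1,
    by positivity, by positivity, one_pos, ?_⟩, inferInstance, N * C / (c * a ^ γ) + 1, γ, 1,
    by positivity, hγ, one_pos, ?_⟩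
  · have := dimH_of_hausdorffMeasure_ne_zero_ne_top (d := s.toNNReal) (s := K)
      (by rwa [Real.coe_toNNReal _ hs0.le]) (by rwa [Real.coe_toNNReal _ hs0.le])
    exact this
  · intro x hx ρ h0 h1
    rw [hsupp] at hx
    rw [hball]
    constructor
    · rw [mul_right_comm, ENNReal.ofReal_mul (by positivity), hM]
      exact hc x hx ρ h0 h1.le
    · obtain ⟨F, hFc, hF⟩ := hN x ρ h0 h1
      refine (h.hausdorffMeasure_closedBall_le hs0.le h0 hFc hF).trans ?_
      rw [mul_right_comm, ENNReal.ofReal_mul (p := (N + 1) * ρ ^ s) (by positivity), hM]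
      gcongr
      linarith
  · intro ρ h0 h1 x hx L hL ε hε
    rw [hsupp] at hx
    have hLp := hL.isProperAffine
    obtain ⟨F, hFc, hF⟩ := hN x ρ h0 h1
    rw [hball, Measure.restrict_apply
      (measurableSet_closedBall.inter isClosed_cthickening.measurableSet)]
    -- Since the ratio of `w` is at least `a * ρ`, pulling back turns width `ε * ρ` into at most `ε
    -- / a`.
    have hterm : ∀ w ∈ F, ENNReal.ofReal (wordRatio r w ^ s) * μH[s] (K ∩ wordMap u w ⁻¹'
        cthickening (ε * ρ) (L : Set (EuclideanSpace ℝ (Fin d)))) ≤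
        ENNReal.ofReal (ρ ^ s) * (ENNReal.ofReal (C * (ε / a) ^ γ) * μH[s] K) := by
      intro w hw
      have hst := ((hF w).1 hw).1
      have hpos := h.ratio_pos w
      have hle := hst.le_wordRatio h.pos ha0 ha h0 h1
      obtain ⟨L', hL', -, hdist⟩ := h.exists_preimage_affine w hLp
      refine mul_le_mul' (ENNReal.ofReal_le_ofReal
        (Real.rpow_le_rpow hpos.le (hst.wordRatio_le h.pos) hs0.le)) ?_
      refine (measure_mono (inter_subset_inter_right K fun y hy => ?_)).trans
        (hC L' hL' (ε / a) (by positivity))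
      have hy' := (mem_cthickening_iff_infDist_le hLp.1 (by positivity)).1 hy
      change infDist y L' ≤ ε / a
      rw [le_div_iff₀ ha0]
      refine le_of_mul_le_mul_right ?_ h0
      calc infDist y L' * a * ρ = (a * ρ) * infDist y L' := by ring
        _ ≤ wordRatio r w * infDist y L' := mul_le_mul_of_nonneg_right hle infDist_nonneg
        _ ≤ ε * ρ := (hdist y).trans hy'
    calc _ ≤ ∑ w ∈ F, ENNReal.ofReal (wordRatio r w ^ s) * μH[s] (K ∩ wordMap u w ⁻¹'
          cthickening (ε * ρ) (L : Set (EuclideanSpace ℝ (Fin d)))) :=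
          h.hausdorffMeasure_closedBall_inter_le hs0.le h0 (fun w h1 h2 => (hF w).2 ⟨h1, h2⟩) _
      _ ≤ ∑ _w ∈ F, ENNReal.ofReal (ρ ^ s) *
          (ENNReal.ofReal (C * (ε / a) ^ γ) * μH[s] K) := Finset.sum_le_sum hterm
      _ ≤ N * (ENNReal.ofReal (ρ ^ s) * (ENNReal.ofReal (C * (ε / a) ^ γ) * μH[s] K)) := by
          rw [Finset.sum_const, nsmul_eq_mul]
          gcongr
      _ = ENNReal.ofReal (N * C / (c * a ^ γ) * ε ^ γ) *
          (ENNReal.ofReal (c * ρ ^ s) * μH[s] K) := by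
          rw [← mul_assoc, ← mul_assoc, ← mul_assoc, ← ENNReal.ofReal_natCast,
            ← ENNReal.ofReal_mul (by positivity), ← ENNReal.ofReal_mul (by positivity),
            ← ENNReal.ofReal_mul (by positivity), Real.div_rpow hε.le ha0.le]
          congr 2
          have : a ^ γ ≠ 0 := by positivity
          field_simp
      _ ≤ ENNReal.ofReal (N * C / (c * a ^ γ) * ε ^ γ) * μH[s] (closedBall x ρ ∩ K) := by
          gcongr
          exact hc x hx ρ h0 h1.le
      _ < _ := by
          refine (ENNReal.mul_lt_mul_iff_left (hballpos x hx ρ h0 h1.le)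
            (ne_top_of_le_ne_top htop (measure_mono inter_subset_right))).2 ?_
          rw [ENNReal.ofReal_lt_ofReal_iff (by positivity)]
          have : 0 < ε ^ γ := by positivity
          linarith

end IsSystem

end Euclidean

end SelfSimilar

theorem mainTheorem8 (d : ℕ) (hd : 1 ≤ d) (m : ℕ)
    (u : Fin m → EuclideanSpace ℝ (Fin d) → EuclideanSpace ℝ (Fin d))
    (hu : ∀ i, SelfSimilar.IsContractingSimilarity (u i))
    (K : Set (EuclideanSpace ℝ (Fin d))) (hK : SelfSimilar.IsLimitSet u K) :
    ((¬ ∃ H : AffineSubspace ℝ (EuclideanSpace ℝ (Fin d)),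
        SelfSimilar.IsHyperplane H ∧ K ⊆ (H : Set (EuclideanSpace ℝ (Fin d)))) ↔
      ¬ ∃ S : Finset (AffineSubspace ℝ (EuclideanSpace ℝ (Fin d))),
        SelfSimilar.IsInvariantCollection u S) ∧
    (SelfSimilar.OpenSetCondition u →
      (¬ ∃ H : AffineSubspace ℝ (EuclideanSpace ℝ (Fin d)),
        SelfSimilar.IsHyperplane H ∧ K ⊆ (H : Set (EuclideanSpace ℝ (Fin d)))) →
      0 < dimH K ∧
      (SelfSimilar.hausdorffOn K).support = K ∧
      SelfSimilar.IsAhlforsRegular (dimH K).toReal (SelfSimilar.hausdorffOn K) ∧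
      SelfSimilar.IsAbsolutelyDecaying (SelfSimilar.hausdorffOn K) ∧
      SelfSimilar.IsHyperplaneDiffuse K) := by
  choose r hr0 hr1 hr using hu
  have h : SelfSimilar.IsSystem u r K := ⟨hr0, hr1, hr, hK.1, hK.2.1, hK.2.2⟩
  refine ⟨h.not_exists_hyperplane_iff, fun hO hnot => ?_⟩
  rw [SelfSimilar.exists_hyperplane_superset_iff] at hnot
  push Not at hnot
  -- Otherwise `K` is a single point, which is a proper affine subspace because `d ≥ 1`.
  have hm : 2 ≤ m := by
    by_contra! hlt
    obtain ⟨x, hx⟩ := h.nonempty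
    have : NeZero d := ⟨by omega⟩
    have hbot : (AffineSubspace.mk' x (⊥ : Submodule ℝ (EuclideanSpace ℝ (Fin d)))) ≠ ⊤ := by
      intro he
      have := congrArg AffineSubspace.direction he
      rw [AffineSubspace.direction_mk', AffineSubspace.direction_top] at this
      exact bot_ne_top this
    refine hnot _ ⟨⟨x, AffineSubspace.self_mem_mk' _ _⟩, hbot⟩ fun y hy => ?_
    rw [h.subsingleton (by omega) hy hx]
    exact AffineSubspace.self_mem_mk' _ _
  obtain ⟨s, hs0, hs⟩ := SelfSimilar.IsSystem.exists_moran_exponent hm hr0 hr1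
  obtain ⟨hdim, hsupp, hreg, hdec⟩ := h.regular_of_openSetCondition hs0 hs hO hnot
  rw [SelfSimilar.hausdorffOn, hdim, ENNReal.toReal_ofReal hs0.le]
  exact ⟨ENNReal.ofReal_pos.2 hs0, hsupp, hreg, hdec, h.isHyperplaneDiffuse hd hnot⟩
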